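/- Let $G$ be a locally compact Hausdorff ample groupoid, i.e. a groupoid with a locally compact Hausdorff topology for which product and inversion are continuous and which has a basis of compact open bisections (a bisection is a set $S\subseteq G$ on which the range map $r(g)=gg^{-1}$ and the domain map $d(g)=g^{-1}g$ both restrict to homeomorphisms onto open subsets of $G$). Let $G^{(0)}$ be its unit space. Let $C_r^*(G)$ be the reduced groupoid $C^*$-algebra, i.e. the completion of the convolution $*$-algebra $C_c(G)$, with $$f_1*f_2(g)=\sum_{h:\,r(h)=r(g)}f_1(h)f_2(h^{-1}g),\qquad f^*(g)=\overline{f(g^{-1})},$$ in the norm $\|f\|_r=\sup_{u\in G^{(0)}}\|\pi_u(f)\|$, where $\pi_u(f)\xi=f*\xi$ on $\ell^2(\{g\in G: d(g)=u\})$; $C_0(G^{(0)})$ is regarded as a subalgebra of $C_r^*(G)$ by extending functions on $G^{(0)}$ by zero. A subset $D\subseteq G^{(0)}$ is invariant if $d(g)\in D$ implies $r(g)\in D$ for all $g\in G$; in that case $G_D=\{g\in G: d(g)\in D\}$ is a groupoid with unit space $D$. The algebras $C_r^*(G_D)$, for $D$ an open or a closed invariant subset, are defined in the same way. Assume that 1.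 $G$ is inner exact: for every closed invariant subset $D\subseteq G^{(0)}$ the sequence $$0\to C_r^*(G_{G^{(0)}\setminus D})\to C_r^*(G)\to C_r^*(G_D)\to 0$$ is exact, where the maps are induced by extending functions in $C_c(G_{G^{(0)}\setminus D})$ by zero and by restricting functions in $C_c(G)$ to $G_D$, respectively; and 2. $G$ has the residual intersection property: for every closed invariant subset $D\subseteq G^{(0)}$ and every nonzero closed two-sided ideal $I\subseteq C_r^*(G_D)$ one has $I\cap C_0(D)\neq\{0\}$. Then $C_r^*(G)$ has the ideal property: every closed two-sided ideal of $C_r^*(G)$ is generated, as a closed two-sided ideal, by the projections it contains. -/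

import Mathlib

open Topology Set Function
open scoped ENNReal CompactlySupported

/-- A groupoid in the one-sorted ("set of arrows") form: a partially defined product and an
inverse. The product is written as a total operation, but only its values on composable pairs
are constrained or used. -/
class PGroupoid (G : Type*) extends Mul G, Inv G where
  /-- the set `G⁽²⁾` of composable pairs -/
  Comp : G → G → Prop
  comp_mul_left {a b c : G} : Comp a b → Comp b c → Comp (a * b) c
  comp_mul_right {a b c : G} : Comp a b → Comp b c → Comp a (b * c)
  mul_assoc' {a b c : G} : Comp a b → Comp b c → a * b * c = a * (b * c)
  comp_inv (a : G) : Comp a a⁻¹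
  comp_inv_mul {a b : G} : Comp a b → Comp a⁻¹ (a * b)
  inv_mul_cancel' {a b : G} : Comp a b → a⁻¹ * (a * b) = b
  comp_mul_inv {a b : G} : Comp a b → Comp (a * b) b⁻¹
  mul_inv_cancel' {a b : G} : Comp a b → a * b * b⁻¹ = a

namespace PGroupoid

section Algebra

variable {G : Type*} [PGroupoid G]

/-- The set of units `G⁽⁰⁾ = {g g⁻¹ | g ∈ G}`. -/
def units (G : Type*) [PGroupoid G] : Set G := {u | ∃ g : G, u = g * g⁻¹}

/-- The unit space `G⁽⁰⁾` (with the relative topology when `G` has a topology). -/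
abbrev UnitSpace (G : Type*) [PGroupoid G] : Type _ := units G

lemma comp_inv_inv_left (a : G) : Comp a⁻¹ a := by
  have h1 : Comp a⁻¹ (a * a⁻¹) := comp_inv_mul (comp_inv a)
  have h2 : Comp (a * a⁻¹) a⁻¹⁻¹ := comp_mul_inv (comp_inv a)
  have h3 := comp_mul_right h1 h2
  rwa [mul_inv_cancel' (comp_inv a)] at h3

lemma pinv_inv (a : G) : a⁻¹⁻¹ = a := by
  have e1 : a⁻¹⁻¹ * (a⁻¹ * a) = a := inv_mul_cancel' (comp_inv_inv_left a)
  have e2 : a⁻¹⁻¹ * (a⁻¹ * a⁻¹⁻¹) = a⁻¹⁻¹ := inv_mul_cancel' (comp_inv a⁻¹)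
  have e3 : a * (a⁻¹ * a⁻¹⁻¹) = a := by
    rw [← mul_assoc' (comp_inv a) (comp_inv a⁻¹), mul_inv_cancel' (comp_inv a)]
  have c : Comp a (a⁻¹ * a⁻¹⁻¹) := comp_mul_right (comp_inv a) (comp_inv a⁻¹)
  have e4 := inv_mul_cancel' c
  rw [e3] at e4
  rw [← e2, ← e4, e1]

lemma inv_mul_mem_units (g : G) : g⁻¹ * g ∈ units G := ⟨g⁻¹, by rw [pinv_inv]⟩

/-- The range map `r(g) = g g⁻¹`. -/
def rng (g : G) : UnitSpace G := ⟨g * g⁻¹, g, rfl⟩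

/-- The domain map `d(g) = g⁻¹ g`. -/
def dom (g : G) : UnitSpace G := ⟨g⁻¹ * g, inv_mul_mem_units g⟩

lemma coe_rng (g : G) : (rng g : G) = g * g⁻¹ := rfl
lemma coe_dom (g : G) : (dom g : G) = g⁻¹ * g := rfl

@[simp] lemma dom_inv (g : G) : dom g⁻¹ = rng g := by
  apply Subtype.ext; rw [coe_dom, coe_rng, pinv_inv]

@[simp] lemma rng_inv (g : G) : rng g⁻¹ = dom g := by
  apply Subtype.ext; rw [coe_dom, coe_rng, pinv_inv]

lemma comp_iff {a b : G} : Comp a b ↔ dom a = rng b := by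
  constructor
  · intro h
    apply Subtype.ext
    rw [coe_dom, coe_rng]
    have h1 : a⁻¹ * a * b = b := by
      rw [mul_assoc' (comp_inv_inv_left a) h, inv_mul_cancel' h]
    have h2 : Comp (a⁻¹ * a) b := comp_mul_left (comp_inv_inv_left a) h
    have h3 := mul_inv_cancel' h2
    rw [h1] at h3
    exact h3.symm
  · intro h
    have h0 : a⁻¹ * a = b * b⁻¹ := congrArg Subtype.val h
    have h1 : Comp a (a⁻¹ * a) := comp_mul_right (comp_inv a) (comp_inv_inv_left a)
    rw [h0] at h1
    have h2 : Comp (b * b⁻¹) b := comp_mul_left (comp_inv b) (comp_inv_inv_left b)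
    have h3 := comp_mul_right h1 h2
    have h4 : b * b⁻¹ * b = b := by
      have := mul_inv_cancel' (comp_inv b)
      rwa [pinv_inv] at this
    rwa [h4] at h3

lemma rng_mul {a b : G} (h : dom a = rng b) : rng (a * b) = rng a := by
  have := comp_iff.1 (comp_inv_mul (comp_iff.2 h))
  rw [dom_inv] at this
  exact this.symm

lemma dom_mul {a b : G} (h : dom a = rng b) : dom (a * b) = dom b := by
  have := comp_iff.1 (comp_mul_inv (comp_iff.2 h))
  rwa [rng_inv] at this

lemma pmul_assoc {a b c : G} (h : dom a = rng b) (h' : dom b = rng c) :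
    a * b * c = a * (b * c) := mul_assoc' (comp_iff.2 h) (comp_iff.2 h')

lemma inv_mul_mul {a b : G} (h : dom a = rng b) : a⁻¹ * (a * b) = b :=
  inv_mul_cancel' (comp_iff.2 h)

lemma mul_mul_inv {a b : G} (h : dom a = rng b) : a * b * b⁻¹ = a :=
  mul_inv_cancel' (comp_iff.2 h)

lemma mul_inv_mul {a b : G} (h : rng a = rng b) : a * (a⁻¹ * b) = b := by
  have := inv_mul_mul (a := a⁻¹) (b := b) (by simpa using h)
  rwa [pinv_inv] at this

lemma mul_inv_mul_right {a b : G} (h : dom a = dom b) : a * b⁻¹ * b = a := by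
  have := mul_mul_inv (a := a) (b := b⁻¹) (by simpa using h)
  rwa [pinv_inv] at this

lemma pmul_inv_rev {a b : G} (h : dom a = rng b) : (a * b)⁻¹ = b⁻¹ * a⁻¹ := by
  have h1 : (a * b)⁻¹ * (a * b * b⁻¹) = b⁻¹ :=
    inv_mul_mul (by rw [dom_mul h, rng_inv])
  rw [mul_mul_inv h] at h1
  rw [← h1, mul_mul_inv]
  rw [dom_inv, rng_mul h]

lemma dom_unit (u : UnitSpace G) : dom (u : G) = u := by
  obtain ⟨_, g, rfl⟩ := u
  have := dom_mul (a := g) (b := g⁻¹) (by rw [rng_inv])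
  rw [dom_inv] at this
  exact this

lemma rng_unit (u : UnitSpace G) : rng (u : G) = u := by
  obtain ⟨_, g, rfl⟩ := u
  exact rng_mul (a := g) (b := g⁻¹) (by rw [rng_inv])

end Algebra

section Topology

/-- A bisection: the range and domain maps restrict to homeomorphisms of `S` onto open subsets
of `G`. -/
def IsBisection {G : Type*} [PGroupoid G] [TopologicalSpace G] (S : Set G) : Prop :=
  IsOpenEmbedding (fun x : S => ((rng (x : G) : UnitSpace G) : G)) ∧
    IsOpenEmbedding (fun x : S => ((dom (x : G) : UnitSpace G) : G))

/-- A Hausdorff topological groupoid. -/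
class TopGroupoid (G : Type*) [PGroupoid G] [TopologicalSpace G] : Prop extends T2Space G where
  continuousOn_mul : ContinuousOn (fun p : G × G => p.1 * p.2) {p | Comp p.1 p.2}
  continuous_inv : Continuous (fun g : G => g⁻¹)

/-- The topology has a basis of open bisections. (Local compactness is
Mathlib's separate type class `LocallyCompactSpace`.) -/
class EtaleGroupoid (G : Type*) [PGroupoid G] [TopologicalSpace G] : Prop
    extends TopGroupoid G where
  isTopologicalBasis_bisection :
    TopologicalSpace.IsTopologicalBasis {S : Set G | IsOpen S ∧ IsBisection S}

/-- The topology has a basis of compact open bisections. -/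
class AmpleGroupoid (G : Type*) [PGroupoid G] [TopologicalSpace G] : Prop
    extends TopGroupoid G where
  isTopologicalBasis_compact_bisection :
    TopologicalSpace.IsTopologicalBasis {S : Set G | IsCompact S ∧ IsOpen S ∧ IsBisection S}

instance AmpleGroupoid.toEtaleGroupoid (G : Type*) [PGroupoid G] [TopologicalSpace G]
    [h : AmpleGroupoid G] : EtaleGroupoid G where
  isTopologicalBasis_bisection :=
    h.isTopologicalBasis_compact_bisection.of_isOpen_of_subset (fun _ hS => hS.1)
      fun _ hS => ⟨hS.2.1, hS.2.2⟩

end Topology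

section TopBasic

variable {G : Type*} [PGroupoid G] [TopologicalSpace G]

lemma continuous_rng [TopGroupoid G] : Continuous (rng : G → UnitSpace G) := by
  refine Continuous.subtype_mk ?_ _
  exact TopGroupoid.continuousOn_mul.comp_continuous
    (continuous_id.prodMk TopGroupoid.continuous_inv) fun g => comp_inv g

lemma continuous_dom [TopGroupoid G] : Continuous (dom : G → UnitSpace G) := by
  rw [show (dom : G → UnitSpace G) = rng ∘ (fun g => g⁻¹) from funext fun g => (rng_inv g).symm]
  exact continuous_rng.comp TopGroupoid.continuous_inv

lemma IsBisection.rng_inj {S : Set G} (hS : IsBisection S) {a b : G} (ha : a ∈ S) (hb : b ∈ S)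
    (h : rng a = rng b) : a = b :=
  congrArg Subtype.val (hS.1.injective (a₁ := ⟨a, ha⟩) (a₂ := ⟨b, hb⟩) (congrArg Subtype.val h))

lemma IsBisection.dom_inj {S : Set G} (hS : IsBisection S) {a b : G} (ha : a ∈ S) (hb : b ∈ S)
    (h : dom a = dom b) : a = b :=
  congrArg Subtype.val (hS.2.injective (a₁ := ⟨a, ha⟩) (a₂ := ⟨b, hb⟩) (congrArg Subtype.val h))

variable [EtaleGroupoid G]

lemma exists_bisection (g : G) {V : Set G} (hV : IsOpen V) (hg : g ∈ V) :
    ∃ S, IsOpen S ∧ IsBisection S ∧ g ∈ S ∧ S ⊆ V := by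
  obtain ⟨S, hS, h1, h2⟩ :=
    (EtaleGroupoid.isTopologicalBasis_bisection (G := G)).exists_subset_of_mem_open hg hV
  exact ⟨S, hS.1, hS.2, h1, h2⟩

lemma isOpen_units : IsOpen (units G) := by
  rw [isOpen_iff_forall_mem_open]
  intro u hu
  obtain ⟨S, hS, hb, hg, -⟩ := exists_bisection u isOpen_univ (mem_univ u)
  refine ⟨_, ?_, hb.2.isOpen_range, ⟨⟨u, hg⟩, ?_⟩⟩
  · rintro _ ⟨x, rfl⟩
    exact (dom (x : G)).2
  · exact congrArg Subtype.val (dom_unit ⟨u, hu⟩)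

lemma isOpenEmbedding_units : IsOpenEmbedding (Subtype.val : UnitSpace G → G) :=
  isOpen_units.isOpenEmbedding_subtypeVal

/-- A compact set meets the fibres of `r` and of `d` in a uniformly bounded number of points. -/
lemma exists_fibre_bound {K : Set G} (hK : IsCompact K) :
    ∃ N : ℕ, ∀ u : UnitSpace G,
      ((K ∩ {g | rng g = u}).Finite ∧ (K ∩ {g | rng g = u}).ncard ≤ N) ∧
      ((K ∩ {g | dom g = u}).Finite ∧ (K ∩ {g | dom g = u}).ncard ≤ N) := by
  choose S hSo hSb hSm _ using fun g : G => exists_bisection g isOpen_univ (mem_univ g)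
  obtain ⟨t, ht⟩ := hK.elim_finite_subcover S hSo fun g _ => mem_iUnion.2 ⟨g, hSm g⟩
  have key : ∀ A : Set G, A ⊆ K → (∀ i a b, a ∈ A → b ∈ A → a ∈ S i → b ∈ S i → a = b) →
      A.Finite ∧ A.ncard ≤ t.card := by
    intro A hA hinj
    have hc : ∀ a ∈ A, ∃ i ∈ t, a ∈ S i := fun a ha => by simpa using ht (hA ha)
    choose! c hct hcS using hc
    have hin : InjOn c A := fun a ha b hb hab =>
      hinj (c a) a b ha hb (hcS a ha) (hab ▸ hcS b hb)
    have hfin : A.Finite := Finite.of_injOn (f := c) (t := (t : Set G)) (fun a ha => hct a ha) hin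
      t.finite_toSet
    refine ⟨hfin, ?_⟩
    rw [← Set.ncard_coe_finset t]
    exact Set.ncard_le_ncard_of_injOn c (fun a ha => hct a ha) hin t.finite_toSet
  refine ⟨t.card, fun u => ⟨key _ inter_subset_left ?_, key _ inter_subset_left ?_⟩⟩
  · rintro i a b ⟨-, ha⟩ ⟨-, hb⟩ hai hbi
    exact (hSb i).rng_inj hai hbi (ha.trans hb.symm)
  · rintro i a b ⟨-, ha⟩ ⟨-, hb⟩ hai hbi
    exact (hSb i).dom_inj hai hbi (ha.trans hb.symm)

end TopBasic
end PGroupoid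

namespace PGroupoid

section Conv

variable {G : Type*} [PGroupoid G]

/-- The value `∑_{h ∈ G^{r(g)}} f₁(h) f₂(h⁻¹ g)` of the convolution product. -/
noncomputable def convFun (f₁ f₂ : G → ℂ) (g : G) : ℂ :=
  ∑ᶠ h : {h : G // rng h = rng g}, f₁ h * f₂ ((h : G)⁻¹ * g)

lemma convFun_ne_zero {f₁ f₂ : G → ℂ} {g : G} (h : convFun f₁ f₂ g ≠ 0) :
    ∃ a b, dom a = rng b ∧ f₁ a ≠ 0 ∧ f₂ b ≠ 0 ∧ a * b = g := by
  obtain ⟨⟨a, ha⟩, hne⟩ : ∃ k : {k : G // rng k = rng g}, f₁ k * f₂ ((k : G)⁻¹ * g) ≠ 0 := by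
    by_contra! hcon
    exact h (finsum_eq_zero_of_forall_eq_zero hcon)
  have h1 : rng (a⁻¹ * g) = dom a := by rw [rng_mul (by rw [dom_inv, ha]), rng_inv]
  exact ⟨a, a⁻¹ * g, h1.symm, left_ne_zero_of_mul hne, right_ne_zero_of_mul hne, mul_inv_mul ha⟩

variable [TopologicalSpace G]

lemma IsBisection.exists_section [TopGroupoid G] {S : Set G} (hS : IsBisection S) {h : G}
    (hh : h ∈ S) :
    ∃ σ : G → G, (∀ g, rng g = rng h → σ g = h) ∧ (∀ g, rng g = rng h → ContinuousAt σ g) ∧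
      ∀ g, rng g = rng h → ∀ᶠ g' in 𝓝 g, σ g' ∈ S ∧ rng (σ g') = rng g' := by
  have : Nonempty S := ⟨⟨h, hh⟩⟩
  set e := hS.1.toOpenPartialHomeomorph _ with he
  have htgt : e.target = range (fun x : S => ((rng (x : G) : UnitSpace G) : G)) := by simp [he]
  have hmem : ∀ g, rng g = rng h → ((rng g : UnitSpace G) : G) ∈ e.target := by
    intro g hg
    rw [htgt, hg]
    exact ⟨⟨h, hh⟩, rfl⟩
  have hc : Continuous (fun g : G => ((rng g : UnitSpace G) : G)) :=
    continuous_subtype_val.comp continuous_rng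
  refine ⟨fun g => (e.symm (rng g : G) : S), ?_, ?_, ?_⟩
  · intro g hg
    have : e.symm (rng g : G) = (⟨h, hh⟩ : S) := by
      rw [hg]
      exact e.left_inv (x := (⟨h, hh⟩ : S)) (by simp [he])
    simp only [this]
  · intro g hg
    exact continuous_subtype_val.continuousAt.comp
      ((e.continuousAt_symm (hmem g hg)).comp (f := fun g : G => ((rng g : UnitSpace G) : G))
        hc.continuousAt)
  · intro g hg
    filter_upwards [hc.continuousAt.preimage_mem_nhds (e.open_target.mem_nhds (hmem g hg))]
      with g' hg'
    exact ⟨(e.symm _).2, Subtype.ext (e.right_inv hg')⟩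

lemma continuous_convFun [EtaleGroupoid G] {f₁ f₂ : G → ℂ} (h₁ : Continuous f₁)
    (hc₁ : HasCompactSupport f₁) (h₂ : Continuous f₂) : Continuous (convFun f₁ f₂) := by
  classical
  rw [continuous_iff_continuousAt]
  intro g₀
  have hK : IsCompact (tsupport f₁) := hc₁
  obtain ⟨N, hN⟩ := exists_fibre_bound hK
  have hfin := (hN (rng g₀)).1.1
  obtain ⟨U, hU, hdisj⟩ := hfin.t2_separation
  choose S hSo hSb hSm hSU using fun g : G => exists_bisection g (hU g).2 (hU g).1
  have hex := fun h : G => (hSb h).exists_section (hSm h)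
  choose σ hσ₀ hσc hσe using hex
  set s := hfin.toFinset with hs
  have hsr : ∀ h ∈ s, rng h = rng g₀ := fun h hh => (hfin.mem_toFinset.1 hh).2
  -- the part of the support outside the chosen bisections does not meet nearby fibres
  have hK' : IsCompact (tsupport f₁ \ ⋃ h ∈ s, S h) :=
    hK.diff (isOpen_biUnion fun h _ => hSo h)
  have hcl : IsClosed (rng '' (tsupport f₁ \ ⋃ h ∈ s, S h)) :=
    (hK'.image continuous_rng).isClosed
  have hnot : rng g₀ ∉ rng '' (tsupport f₁ \ ⋃ h ∈ s, S h) := by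
    rintro ⟨k, ⟨hk1, hk2⟩, hk3⟩
    exact hk2 (mem_biUnion (hfin.mem_toFinset.2 ⟨hk1, hk3⟩) (hSm k))
  have ev1 : ∀ᶠ g in 𝓝 g₀, rng g ∉ rng '' (tsupport f₁ \ ⋃ h ∈ s, S h) :=
    (continuous_rng (G := G)).continuousAt.preimage_mem_nhds (hcl.isOpen_compl.mem_nhds hnot)
  have ev2 : ∀ᶠ g in 𝓝 g₀, ∀ h ∈ s, σ h g ∈ S h ∧ rng (σ h g) = rng g :=
    (Filter.eventually_all_finset s).2 fun h hh => hσe h g₀ (hsr h hh).symm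
  have heq : convFun f₁ f₂ =ᶠ[𝓝 g₀] fun g => ∑ h ∈ s, f₁ (σ h g) * f₂ ((σ h g)⁻¹ * g) := by
    filter_upwards [ev1, ev2] with g hg1 hg2
    have hinj : InjOn (fun h => σ h g) (s : Set G) := by
      intro a ha b hb hab
      by_contra hne
      have hd := hdisj (hfin.mem_toFinset.1 ha) (hfin.mem_toFinset.1 hb) hne
      exact disjoint_left.1 hd (hSU a (hg2 a ha).1) (by
        simp only at hab
        rw [hab]; exact hSU b (hg2 b hb).1)
    rw [← Finset.sum_image (f := fun k => f₁ k * f₂ (k⁻¹ * g)) hinj]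
    unfold convFun
    rw [finsum_subtype_eq_finsum_cond (f := fun k => f₁ k * f₂ (k⁻¹ * g)) (fun k => rng k = rng g)]
    refine finsum_mem_eq_sum_of_inter_support_eq (s := {k | rng k = rng g}) _ ?_
    ext k
    simp only [mem_inter_iff, mem_ofPred_eq, mem_support, Finset.coe_image, mem_image,
      Finset.mem_coe]
    refine and_congr_left fun hk => ⟨fun hr => ?_, ?_⟩
    · have hkK : k ∈ tsupport f₁ := subset_tsupport _ (left_ne_zero_of_mul hk)
      have : k ∈ ⋃ h ∈ s, S h := by
        by_contra hcon
        exact hg1 ⟨k, ⟨hkK, hcon⟩, hr⟩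
      simp only [mem_iUnion] at this
      obtain ⟨h, hh, hkS⟩ := this
      exact ⟨h, hh, (hSb h).rng_inj (hg2 h hh).1 hkS ((hg2 h hh).2.trans hr.symm)⟩
    · rintro ⟨h, hh, rfl⟩
      exact (hg2 h hh).2
  refine ContinuousAt.congr ?_ heq.symm
  refine tendsto_finsetSum _ fun h hh => ?_
  have c1 := hσc h g₀ (hsr h hh).symm
  refine (h₁.continuousAt.comp c1).mul (h₂.continuousAt.comp ?_)
  have hcomp : ∀ᶠ g in 𝓝 g₀, Comp (σ h g)⁻¹ g := by
    filter_upwards [ev2] with g hg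
    rw [comp_iff, dom_inv, (hg h hh).2]
  have cw : ContinuousWithinAt (fun p : G × G => p.1 * p.2) {p | Comp p.1 p.2}
      ((σ h g₀)⁻¹, g₀) := TopGroupoid.continuousOn_mul _ hcomp.self_of_nhds
  exact cw.tendsto.comp (tendsto_nhdsWithin_iff.2
    ⟨((TopGroupoid.continuous_inv.continuousAt.comp c1).prodMk continuousAt_id).tendsto, hcomp⟩)

lemma hasCompactSupport_convFun [TopGroupoid G] {f₁ f₂ : G → ℂ}
    (hc₁ : HasCompactSupport f₁) (hc₂ : HasCompactSupport f₂) :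
    HasCompactSupport (convFun f₁ f₂) := by
  have hcl : IsClosed {p : G × G | Comp p.1 p.2} := by
    simp only [comp_iff]
    exact isClosed_eq (continuous_dom.comp continuous_fst) (continuous_rng.comp continuous_snd)
  have hK : IsCompact ((tsupport f₁ ×ˢ tsupport f₂) ∩ {p : G × G | Comp p.1 p.2}) :=
    (hc₁.prod hc₂).inter_right hcl
  have hI := hK.image_of_continuousOn
    (TopGroupoid.continuousOn_mul.mono inter_subset_right)
  refine HasCompactSupport.intro hI fun g hg => ?_
  by_contra hne
  obtain ⟨a, b, hab, ha, hb, rfl⟩ := convFun_ne_zero hne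
  exact hg ⟨(a, b), ⟨⟨subset_tsupport _ ha, subset_tsupport _ hb⟩, comp_iff.2 hab⟩, rfl⟩

/-- The convolution product on `C_c(G)`. -/
noncomputable def conv [EtaleGroupoid G] (f₁ f₂ : C_c(G, ℂ)) : C_c(G, ℂ) where
  toFun := convFun f₁ f₂
  continuous_toFun := continuous_convFun f₁.continuous f₁.hasCompactSupport f₂.continuous
  hasCompactSupport' := hasCompactSupport_convFun f₁.hasCompactSupport f₂.hasCompactSupport

/-- The involution `f*(g) = conj (f (g⁻¹))` on `C_c(G)`. -/
noncomputable def invol [TopGroupoid G] (f : C_c(G, ℂ)) : C_c(G, ℂ) where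
  toFun g := starRingEnd ℂ (f g⁻¹)
  continuous_toFun :=
    Complex.continuous_conj.comp (f.continuous.comp TopGroupoid.continuous_inv)
  hasCompactSupport' := by
    refine HasCompactSupport.intro
      (IsCompact.image (f.hasCompactSupport : IsCompact (tsupport f))
        TopGroupoid.continuous_inv) fun g hg => ?_
    by_contra hne
    refine hg ⟨g⁻¹, subset_tsupport _ fun h0 => hne ?_, pinv_inv g⟩
    rw [h0, map_zero]

end Conv

end PGroupoid

namespace PGroupoid

section Kernel

variable {X : Type*}

/-- A kernel with at most `N` nonzero entries in each row and column, all bounded by `M`. -/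
structure IsBandKernel (a : X → X → ℂ) (N : ℕ) (M : ℝ) : Prop where
  row_finite (x : X) : {y | a x y ≠ 0}.Finite
  row_card (x : X) : {y | a x y ≠ 0}.ncard ≤ N
  col_finite (y : X) : {x | a x y ≠ 0}.Finite
  col_card (y : X) : {x | a x y ≠ 0}.ncard ≤ N
  norm_le (x y : X) : ‖a x y‖ ≤ M

variable {a : X → X → ℂ} {N : ℕ} {M : ℝ}

lemma IsBandKernel.finsum_eq (h : IsBandKernel a N M) (ξ : X → ℂ) (x : X) :
    ∑ᶠ y, a x y * ξ y = ∑ y ∈ (h.row_finite x).toFinset, a x y * ξ y :=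
  finsum_eq_sum_of_support_subset _ fun y hy => by
    simpa using left_ne_zero_of_mul hy

lemma IsBandKernel.norm_sq_le (h : IsBandKernel a N M) (ξ : X → ℂ) (x : X) :
    ‖∑ᶠ y, a x y * ξ y‖ ^ 2 ≤ N * M ^ 2 * ∑ y ∈ (h.row_finite x).toFinset, ‖ξ y‖ ^ 2 := by
  rw [h.finsum_eq]
  have hM : 0 ≤ M := (norm_nonneg _).trans (h.norm_le x x)
  have h1 : ‖∑ y ∈ (h.row_finite x).toFinset, a x y * ξ y‖
      ≤ ∑ y ∈ (h.row_finite x).toFinset, M * ‖ξ y‖ := by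
    refine (norm_sum_le _ _).trans (Finset.sum_le_sum fun y _ => ?_)
    rw [norm_mul]
    exact mul_le_mul_of_nonneg_right (h.norm_le x y) (norm_nonneg _)
  have h2 : ((h.row_finite x).toFinset.card : ℝ) ≤ N := by
    rw [← Set.ncard_eq_toFinset_card _ (h.row_finite x)]
    exact_mod_cast h.row_card x
  calc _ ≤ (∑ y ∈ (h.row_finite x).toFinset, M * ‖ξ y‖) ^ 2 := by gcongr
    _ ≤ (h.row_finite x).toFinset.card * ∑ y ∈ (h.row_finite x).toFinset, (M * ‖ξ y‖) ^ 2 :=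
        sq_sum_le_card_mul_sum_sq
    _ ≤ N * ∑ y ∈ (h.row_finite x).toFinset, (M * ‖ξ y‖) ^ 2 := by gcongr
    _ = _ := by
        simp_rw [mul_pow]
        rw [← Finset.mul_sum, mul_assoc]

lemma IsBandKernel.sum_le (h : IsBandKernel a N M) (ξ : lp (fun _ : X => ℂ) 2) (s : Finset X) :
    ∑ x ∈ s, ‖∑ᶠ y, a x y * ξ y‖ ^ 2 ≤ (N * M * ‖ξ‖) ^ 2 := by
  classical
  have hsum : ∀ t : Finset X, ∑ y ∈ t, ‖ξ y‖ ^ 2 ≤ ‖ξ‖ ^ 2 := fun t => by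
    simpa using lp.sum_rpow_le_norm_rpow (p := 2) (by norm_num) ξ t
  set t := s.biUnion fun x => (h.row_finite x).toFinset
  calc ∑ x ∈ s, ‖∑ᶠ y, a x y * ξ y‖ ^ 2
      ≤ ∑ x ∈ s, N * M ^ 2 * ∑ y ∈ (h.row_finite x).toFinset, ‖ξ y‖ ^ 2 :=
        Finset.sum_le_sum fun x _ => h.norm_sq_le ξ x
    _ = N * M ^ 2 * ∑ x ∈ s, ∑ y ∈ (h.row_finite x).toFinset, ‖ξ y‖ ^ 2 := by
        rw [← Finset.mul_sum]
    _ = N * M ^ 2 * ∑ y ∈ t, ∑ x ∈ s with a x y ≠ 0, ‖ξ y‖ ^ 2 := by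
        congr 1
        refine Finset.sum_comm' fun x y => ?_
        simp only [Finite.mem_toFinset, mem_ofPred_eq, Finset.mem_filter, t, Finset.mem_biUnion]
        exact ⟨fun ⟨h1, h2⟩ => ⟨⟨h1, h2⟩, x, h1, h2⟩, fun ⟨⟨h1, h2⟩, _⟩ => ⟨h1, h2⟩⟩
    _ ≤ N * M ^ 2 * ∑ y ∈ t, N * ‖ξ y‖ ^ 2 := by
        gcongr with y hy
        rw [Finset.sum_const, nsmul_eq_mul]
        gcongr
        refine le_trans ?_ (h.col_card y)
        rw [← Set.ncard_coe_finset]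
        exact Set.ncard_le_ncard (fun x hx => by
          simp only [Finset.coe_filter, mem_ofPred_eq] at hx; exact hx.2) (h.col_finite y)
    _ ≤ N * M ^ 2 * (N * ‖ξ‖ ^ 2) := by
        rw [← Finset.mul_sum]
        gcongr
        exact hsum t
    _ = _ := by ring

lemma IsBandKernel.memℓp (h : IsBandKernel a N M) (ξ : lp (fun _ : X => ℂ) 2) :
    Memℓp (fun x => ∑ᶠ y, a x y * ξ y) 2 :=
  memℓp_gen' (C := (N * M * ‖ξ‖) ^ 2) fun s => by simpa using h.sum_le ξ s

lemma IsBandKernel.norm_le' (h : IsBandKernel a N M) (hM : 0 ≤ M) (ξ : lp (fun _ : X => ℂ) 2) :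
    ‖(⟨fun x => ∑ᶠ y, a x y * ξ y, h.memℓp ξ⟩ : lp (fun _ : X => ℂ) 2)‖ ≤ N * M * ‖ξ‖ :=
  lp.norm_le_of_forall_sum_le (by norm_num) (by positivity) fun s => by
    simpa using h.sum_le ξ s

/-- Operators on `ℓ²(X)` are determined by their matrix entries. -/
lemma ext_single [DecidableEq X] {S T : lp (fun _ : X => ℂ) 2 →L[ℂ] lp (fun _ : X => ℂ) 2}
    (h : ∀ x y, S (lp.single 2 x 1) y = T (lp.single 2 x 1) y) : S = T := by
  refine lp.ext_continuousLinearMap (by simp) fun x => ?_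
  refine ContinuousLinearMap.ext_ring ?_
  exact lp.ext (funext fun y => h x y)

end Kernel

section RegularRepresentation

variable {G : Type*} [PGroupoid G]

/-- The fibre `G_u = {g ∈ G | d(g) = u}`. -/
abbrev Src (u : UnitSpace G) : Type _ := {g : G // dom g = u}

/-- The Hilbert space `ℓ²(G_u)`. -/
abbrev L2 (u : UnitSpace G) : Type _ := lp (fun _ : Src u => ℂ) 2

lemma dom_inv_mul {u : UnitSpace G} (g : Src u) (h : {h : G // rng h = rng (g : G)}) :
    dom ((h : G)⁻¹ * (g : G)) = u := by
  rw [dom_mul (by rw [dom_inv, h.2]), g.2]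

/-- The function `f ∗ ξ` on `G_u`, i.e. `(f ∗ ξ)(g) = ∑_{h ∈ G^{r(g)}} f(h) ξ(h⁻¹ g)`. -/
noncomputable def regRepFun (u : UnitSpace G) (f : G → ℂ) (ξ : Src u → ℂ) (g : Src u) : ℂ :=
  ∑ᶠ h : {h : G // rng h = rng (g : G)}, f h * ξ ⟨(h : G)⁻¹ * g, dom_inv_mul g h⟩

/-- The bijection `k ↦ g k⁻¹` from `G_u` to `G^{r(g)}`. -/
def srcEquiv {u : UnitSpace G} (g : Src u) : Src u ≃ {h : G // rng h = rng (g : G)} where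
  toFun k := ⟨g * (k : G)⁻¹, rng_mul (by rw [rng_inv, g.2, k.2])⟩
  invFun h := ⟨(h : G)⁻¹ * g, dom_inv_mul g h⟩
  left_inv k := by
    apply Subtype.ext
    have hgk : dom (g : G) = rng (k : G)⁻¹ := by rw [rng_inv, g.2, k.2]
    simp only
    rw [pmul_inv_rev hgk, pinv_inv, pmul_assoc (by rw [rng_inv, k.2, g.2]) (by rw [dom_inv])]
    have := inv_mul_mul (a := (g : G)⁻¹) (b := g) (by rw [dom_inv])
    rw [← pmul_assoc (by rw [rng_inv, k.2, g.2]) (by rw [dom_inv])]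
    exact mul_inv_mul_right (by rw [k.2, g.2])
  right_inv h := by
    apply Subtype.ext
    have h1 : dom (h : G)⁻¹ = rng (g : G) := by rw [dom_inv, h.2]
    simp only
    rw [pmul_inv_rev h1, pinv_inv, ← pmul_assoc (by rw [rng_inv]) (by rw [dom_inv, h.2])]
    have := mul_mul_inv (a := (g : G)) (b := (g : G)⁻¹) (by rw [rng_inv])
    rw [pmul_assoc (by rw [rng_inv]) (by rw [dom_inv, h.2])]
    exact mul_inv_mul h.2.symm

lemma regRepFun_eq (u : UnitSpace G) (f : G → ℂ) (ξ : Src u → ℂ) (g : Src u) :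
    regRepFun u f ξ g = ∑ᶠ k : Src u, f (g * (k : G)⁻¹) * ξ k := by
  unfold regRepFun
  rw [← finsum_comp_equiv (srcEquiv g)]
  refine finsum_congr fun k => ?_
  congr 2
  exact (srcEquiv g).left_inv k

variable [TopologicalSpace G] [EtaleGroupoid G]

lemma exists_isBandKernel (f : C_c(G, ℂ)) : ∃ (N : ℕ) (M : ℝ), 0 ≤ M ∧ ∀ u : UnitSpace G,
    IsBandKernel (fun g k : Src u => f ((g : G) * (k : G)⁻¹)) N M := by
  obtain ⟨N, hN⟩ := exists_fibre_bound (f.hasCompactSupport : IsCompact (tsupport f))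
  obtain ⟨M, hM⟩ := f.hasCompactSupport.exists_bound_of_continuous f.continuous
  have hgk : ∀ {u : UnitSpace G} (g k : Src u), dom (g : G) = rng (k : G)⁻¹ := fun g k => by
    rw [rng_inv, g.2, k.2]
  refine ⟨N, max M 0, le_max_right _ _, fun u => ?_⟩
  have row : ∀ g : Src u, MapsTo (fun k : Src u => (g : G) * (k : G)⁻¹)
      {k | f ((g : G) * (k : G)⁻¹) ≠ 0} (tsupport f ∩ {h | rng h = rng (g : G)}) :=
    fun g k hk => ⟨subset_tsupport _ hk, rng_mul (hgk g k)⟩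
  have rowinj : ∀ g : Src u, InjOn (fun k : Src u => (g : G) * (k : G)⁻¹)
      {k | f ((g : G) * (k : G)⁻¹) ≠ 0} := fun g k _ k' _ h => by
    have h1 := inv_mul_mul (hgk g k)
    simp only at h
    rw [h, inv_mul_mul (hgk g k')] at h1
    apply Subtype.ext
    rw [← pinv_inv (k : G), ← h1, pinv_inv]
  have col : ∀ k : Src u, MapsTo (fun g : Src u => (g : G) * (k : G)⁻¹)
      {g | f ((g : G) * (k : G)⁻¹) ≠ 0} (tsupport f ∩ {h | dom h = rng (k : G)}) :=
    fun k g hg => ⟨subset_tsupport _ hg, by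
      simp only [mem_ofPred_eq]
      rw [dom_mul (hgk g k), dom_inv]⟩
  have colinj : ∀ k : Src u, InjOn (fun g : Src u => (g : G) * (k : G)⁻¹)
      {g | f ((g : G) * (k : G)⁻¹) ≠ 0} := fun k g _ g' _ h => by
    have h1 := mul_mul_inv (hgk g k)
    simp only at h
    rw [h, mul_mul_inv (hgk g' k)] at h1
    exact Subtype.ext h1.symm
  exact
    { row_finite := fun g => Finite.of_injOn (row g) (rowinj g) (hN _).1.1
      row_card := fun g =>
        (Set.ncard_le_ncard_of_injOn _ (row g) (rowinj g) (hN _).1.1).trans (hN _).1.2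
      col_finite := fun k => Finite.of_injOn (col k) (colinj k) (hN _).2.1
      col_card := fun k =>
        (Set.ncard_le_ncard_of_injOn _ (col k) (colinj k) (hN _).2.1).trans (hN _).2.2
      norm_le := fun g k => (hM _).trans (le_max_left _ _) }

lemma exists_regRepFun_bound (f : C_c(G, ℂ)) : ∃ C : ℝ, 0 ≤ C ∧ ∀ (u : UnitSpace G) (ξ : L2 u),
    ∃ h : Memℓp (regRepFun u f ξ) 2, ‖(⟨regRepFun u f ξ, h⟩ : L2 u)‖ ≤ C * ‖ξ‖ := by
  obtain ⟨N, M, hM, h⟩ := exists_isBandKernel f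
  refine ⟨N * M, by positivity, fun u ξ => ?_⟩
  have e : regRepFun u f ξ = fun g : Src u => ∑ᶠ k : Src u, f (g * (k : G)⁻¹) * ξ k :=
    funext fun g => regRepFun_eq u f ξ g
  rw [e]
  exact ⟨(h u).memℓp ξ, (h u).norm_le' hM ξ⟩

lemma finite_support_kernel (f : C_c(G, ℂ)) {u : UnitSpace G} (ξ : Src u → ℂ) (g : Src u) :
    (support fun k : Src u => f (g * (k : G)⁻¹) * ξ k).Finite := by
  obtain ⟨N, M, -, h⟩ := exists_isBandKernel f
  exact ((h u).row_finite g).subset fun k hk => left_ne_zero_of_mul hk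

/-- The regular representation `π_u : C_c(G) → B(ℓ²(G_u))`, `π_u(f) ξ = f ∗ ξ`. -/
noncomputable def regRep (u : UnitSpace G) : C_c(G, ℂ) →ₗ[ℂ] (L2 u →L[ℂ] L2 u) where
  toFun f := LinearMap.mkContinuousOfExistsBound
    { toFun := fun ξ => ⟨regRepFun u f ξ, ((exists_regRepFun_bound f).choose_spec.2 u ξ).choose⟩
      map_add' := fun ξ η => by
        apply lp.ext
        funext g
        simp only [lp.coeFn_add, Pi.add_apply, regRepFun_eq, mul_add]
        exact finsum_add_distrib (finite_support_kernel f _ g) (finite_support_kernel f _ g)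
      map_smul' := fun c ξ => by
        apply lp.ext
        funext g
        simp only [lp.coeFn_smul, Pi.smul_apply, regRepFun_eq, smul_eq_mul, RingHom.id_apply,
          mul_left_comm _ c]
        exact (mul_finsum _ c).symm }
    ⟨_, fun ξ => ((exists_regRepFun_bound f).choose_spec.2 u ξ).choose_spec⟩
  map_add' f₁ f₂ := by
    ext ξ g
    simp only [LinearMap.mkContinuousOfExistsBound_apply, LinearMap.coe_mk, AddHom.coe_mk,
      add_apply, lp.coeFn_add, Pi.add_apply, regRepFun_eq,
      CompactlySupportedContinuousMap.coe_add, add_mul]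
    exact finsum_add_distrib (finite_support_kernel f₁ _ g) (finite_support_kernel f₂ _ g)
  map_smul' c f := by
    ext ξ g
    simp only [LinearMap.mkContinuousOfExistsBound_apply, LinearMap.coe_mk, AddHom.coe_mk,
      smul_apply, lp.coeFn_smul, Pi.smul_apply, regRepFun_eq, smul_eq_mul, RingHom.id_apply,
      CompactlySupportedContinuousMap.coe_smul, mul_assoc]
    exact (mul_finsum _ c).symm

lemma regRep_apply (u : UnitSpace G) (f : C_c(G, ℂ)) (ξ : L2 u) (g : Src u) :
    regRep u f ξ g =
      ∑ᶠ h : {h : G // rng h = rng (g : G)}, f h * ξ ⟨(h : G)⁻¹ * g, dom_inv_mul g h⟩ := rfl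

lemma regRep_apply' (u : UnitSpace G) (f : C_c(G, ℂ)) (ξ : L2 u) (g : Src u) :
    regRep u f ξ g = ∑ᶠ k : Src u, f (g * (k : G)⁻¹) * ξ k := regRepFun_eq u f ξ g

end RegularRepresentation

end PGroupoid

namespace PGroupoid

section ReducedAlgebra

variable {G : Type*} [PGroupoid G] [TopologicalSpace G] [EtaleGroupoid G]

lemma norm_regRep_bddAbove (f : C_c(G, ℂ)) :
    Memℓp (fun u : UnitSpace G => regRep u f) ∞ := by
  obtain ⟨C, hC, h⟩ := exists_regRepFun_bound f
  refine memℓp_infty ⟨C, ?_⟩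
  rintro _ ⟨u, rfl⟩
  exact ContinuousLinearMap.opNorm_le_bound _ hC fun ξ => (h u ξ).choose_spec

/-- The `C⋆`-algebra of bounded families of operators in `∏_u B(ℓ²(G_u))`, whose norm is the
supremum norm. -/
def OpFamily (G : Type*) [PGroupoid G] : Type _ :=
  lp (fun u : UnitSpace G => L2 u →L[ℂ] L2 u) ∞

noncomputable instance (G : Type*) [PGroupoid G] : NonUnitalCStarAlgebra (OpFamily G) :=
  inferInstanceAs (NonUnitalCStarAlgebra (lp (fun u : UnitSpace G => L2 u →L[ℂ] L2 u) ∞))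

/-- The map `f ↦ (π_u(f))_u`. By definition of the norm of `OpFamily G`, the norm of
`regRepFamily G f` is the reduced norm `sup_u ‖π_u(f)‖`. -/
noncomputable def regRepFamily (G : Type*) [PGroupoid G] [TopologicalSpace G] [EtaleGroupoid G] :
    C_c(G, ℂ) →ₗ[ℂ] OpFamily G where
  toFun f := ⟨fun u => regRep u f, norm_regRep_bddAbove f⟩
  map_add' f₁ f₂ := lp.ext (funext fun u => map_add (regRep u) f₁ f₂)
  map_smul' c f := lp.ext (funext fun u => map_smul (regRep u) c f)

lemma norm_regRepFamily (f : C_c(G, ℂ)) :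
    ‖regRepFamily G f‖ = ⨆ u : UnitSpace G, ‖regRep u f‖ := rfl

lemma regRep_single [DecidableEq G] (u : UnitSpace G) (f : C_c(G, ℂ)) (k g : Src u) :
    regRep u f (lp.single 2 k 1) g = f (g * (k : G)⁻¹) := by
  rw [regRep_apply', finsum_eq_single _ k]
  · simp
  · intro j hj
    simp [lp.single_apply, hj]

lemma regRep_conv (u : UnitSpace G) (f₁ f₂ : C_c(G, ℂ)) :
    regRep u (conv f₁ f₂) = regRep u f₁ * regRep u f₂ := by
  classical
  refine ext_single fun k g => ?_
  rw [regRep_single, mul_apply_eq_comp, regRep_apply]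
  simp only [regRep_single]
  change convFun f₁ f₂ _ = _
  unfold convFun
  have hgk : dom (g : G) = rng (k : G)⁻¹ := by rw [rng_inv, g.2, k.2]
  rw [← finsum_comp_equiv (Equiv.subtypeEquivRight
    (fun h : G => (by rw [rng_mul hgk] : rng h = rng (g : G) ↔ rng h = rng ((g : G) * (k : G)⁻¹))))]
  refine finsum_congr fun h => ?_
  simp only [Equiv.subtypeEquivRight_apply_coe]
  rw [pmul_assoc (by rw [dom_inv, h.2]) hgk]

lemma regRep_invol (u : UnitSpace G) (f : C_c(G, ℂ)) :
    regRep u (invol f) = star (regRep u f) := by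
  classical
  refine ext_single fun k g => ?_
  rw [regRep_single]
  have h1 : (star (regRep u f) (lp.single 2 k 1)) g
      = inner ℂ (lp.single 2 g (1 : ℂ)) (star (regRep u f) (lp.single 2 k 1)) := by
    rw [lp.inner_single_left]
    simp
  rw [h1, ContinuousLinearMap.star_eq_adjoint, ContinuousLinearMap.adjoint_inner_right,
    lp.inner_single_right, regRep_single]
  change starRingEnd ℂ (f _) = _
  have hgk : dom (g : G) = rng (k : G)⁻¹ := by rw [rng_inv, g.2, k.2]
  rw [pmul_inv_rev hgk, pinv_inv]
  simp

/-- The image of the convolution `*`-algebra `C_c(G)` under `f ↦ (π_u(f))_u`. -/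
noncomputable def regRepRange (G : Type*) [PGroupoid G] [TopologicalSpace G] [EtaleGroupoid G] :
    NonUnitalStarSubalgebra ℂ (OpFamily G) where
  carrier := range (regRepFamily G)
  add_mem' := by
    rintro _ _ ⟨f₁, rfl⟩ ⟨f₂, rfl⟩
    exact ⟨f₁ + f₂, map_add _ _ _⟩
  zero_mem' := ⟨0, map_zero _⟩
  mul_mem' := by
    rintro _ _ ⟨f₁, rfl⟩ ⟨f₂, rfl⟩
    exact ⟨conv f₁ f₂, lp.ext (funext fun u => regRep_conv u f₁ f₂)⟩
  smul_mem' := by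
    rintro c _ ⟨f, rfl⟩
    exact ⟨c • f, map_smul _ _ _⟩
  star_mem' := by
    rintro _ ⟨f, rfl⟩
    exact ⟨invol f, lp.ext (funext fun u => regRep_invol u f)⟩

/-- The reduced groupoid `C⋆`-algebra `C_r^*(G)`: the completion of `C_c(G)` with respect to the
reduced norm `sup_u ‖π_u(f)‖`, realised as the closure of the image of `C_c(G)` in the
`C⋆`-algebra of bounded families `∏_u B(ℓ²(G_u))`. -/
def ReducedCStar (G : Type*) [PGroupoid G] [TopologicalSpace G] [EtaleGroupoid G] : Type _ :=
  (regRepRange G).topologicalClosure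

instance : IsClosed ((regRepRange G).topologicalClosure : Set (OpFamily G)) :=
  NonUnitalStarSubalgebra.isClosed_topologicalClosure _

noncomputable instance : NonUnitalCStarAlgebra (ReducedCStar G) :=
  inferInstanceAs (NonUnitalCStarAlgebra (regRepRange G).topologicalClosure)

/-- The canonical map `C_c(G) → C_r^*(G)`. -/
noncomputable def toReduced (G : Type*) [PGroupoid G] [TopologicalSpace G] [EtaleGroupoid G] :
    C_c(G, ℂ) →ₗ[ℂ] ReducedCStar G where
  toFun f := ⟨regRepFamily G f, NonUnitalStarSubalgebra.le_topologicalClosure _ ⟨f, rfl⟩⟩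
  map_add' f₁ f₂ := Subtype.ext (map_add (regRepFamily G) f₁ f₂)
  map_smul' c f := Subtype.ext (map_smul (regRepFamily G) c f)

lemma norm_toReduced (f : C_c(G, ℂ)) :
    ‖toReduced G f‖ = ⨆ u : UnitSpace G, ‖regRep u f‖ := rfl

lemma toReduced_conv (f₁ f₂ : C_c(G, ℂ)) :
    toReduced G (conv f₁ f₂) = toReduced G f₁ * toReduced G f₂ :=
  Subtype.ext (lp.ext (funext fun u => regRep_conv u f₁ f₂))

lemma toReduced_invol (f : C_c(G, ℂ)) : toReduced G (invol f) = star (toReduced G f) :=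
  Subtype.ext (lp.ext (funext fun u => regRep_invol u f))

lemma norm_toReduced_le_iff (f : C_c(G, ℂ)) {C : ℝ} (hC : 0 ≤ C) :
    ‖toReduced G f‖ ≤ C ↔ ∀ u : UnitSpace G, ‖regRep u f‖ ≤ C :=
  ⟨fun h u => (le_ciSup (norm_regRep_bddAbove f).bddAbove u).trans h, fun h => by
    rw [norm_toReduced]; exact Real.iSup_le h hC⟩

lemma denseRange_toReduced : DenseRange (toReduced G) := by
  rintro ⟨x, hx⟩
  have key : (⟨x, hx⟩ : (regRepRange G).topologicalClosure) ∈
      closure {y : (regRepRange G).topologicalClosure | ∃ f, regRepFamily G f = y} := by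
    rw [closure_subtype]
    refine closure_mono ?_ hx
    rintro _ ⟨f, rfl⟩
    exact ⟨⟨_, (toReduced G f).2⟩, ⟨f, rfl⟩, rfl⟩
  refine closure_mono ?_ key
  rintro ⟨_, _⟩ ⟨f, rfl⟩
  exact ⟨f, rfl⟩

end ReducedAlgebra

section ExtendByZero

variable {X Y : Type*} [TopologicalSpace X] [TopologicalSpace Y] [T2Space Y]

/-- Extension by zero of compactly supported functions along an open embedding. -/
noncomputable def extendZero (e : X → Y) (he : IsOpenEmbedding e) :
    C_c(X, ℂ) →ₗ[ℂ] C_c(Y, ℂ) where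
  toFun f :=
    { toFun := extend e f 0
      continuous_toFun := by
        rw [continuous_iff_continuousAt]
        intro y
        by_cases hy : y ∈ range e
        · obtain ⟨x, rfl⟩ := hy
          rw [← he.continuousAt_iff, extend_comp he.injective]
          exact f.continuous.continuousAt
        · have hK : IsClosed (e '' tsupport f) :=
            (IsCompact.image (f.hasCompactSupport : IsCompact (tsupport f)) he.continuous).isClosed
          have hy' : y ∈ (e '' tsupport f)ᶜ := fun ⟨x, _, hx⟩ => hy ⟨x, hx⟩
          have ev : extend e f 0 =ᶠ[𝓝 y] fun _ => 0 := by
            filter_upwards [hK.isOpen_compl.mem_nhds hy'] with z hz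
            by_cases hzr : z ∈ range e
            · obtain ⟨x, rfl⟩ := hzr
              rw [he.injective.extend_apply]
              exact image_eq_zero_of_notMem_tsupport fun hx => hz ⟨x, hx, rfl⟩
            · rw [extend_apply' _ _ _ hzr]; rfl
          exact continuousAt_const.congr ev.symm
      hasCompactSupport' := by
        refine HasCompactSupport.intro
          (IsCompact.image (f.hasCompactSupport : IsCompact (tsupport f)) he.continuous)
          fun z hz => ?_
        by_cases hzr : z ∈ range e
        · obtain ⟨x, rfl⟩ := hzr
          rw [he.injective.extend_apply]
          exact image_eq_zero_of_notMem_tsupport fun hx => hz ⟨x, hx, rfl⟩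
        · rw [extend_apply' _ _ _ hzr]; rfl }
  map_add' f₁ f₂ := by
    ext y
    by_cases hy : y ∈ range e
    · obtain ⟨x, rfl⟩ := hy
      simp [he.injective.extend_apply]
    · simp [extend_apply' _ _ _ hy]
  map_smul' c f := by
    ext y
    by_cases hy : y ∈ range e
    · obtain ⟨x, rfl⟩ := hy
      simp [he.injective.extend_apply]
    · simp [extend_apply' _ _ _ hy]

lemma extendZero_apply (e : X → Y) (he : IsOpenEmbedding e) (f : C_c(X, ℂ)) (x : X) :
    extendZero e he f (e x) = f x :=
  he.injective.extend_apply f 0 x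

lemma extendZero_apply' (e : X → Y) (he : IsOpenEmbedding e) (f : C_c(X, ℂ)) (y : Y)
    (hy : y ∉ range e) : extendZero e he f y = 0 :=
  extend_apply' _ _ _ hy

/-- Restriction of compactly supported functions along a closed embedding. -/
noncomputable def restrictClosed (e : X → Y) (he : IsClosedEmbedding e) :
    C_c(Y, ℂ) →ₗ[ℂ] C_c(X, ℂ) where
  toFun f :=
    { toFun := f ∘ e
      continuous_toFun := f.continuous.comp he.continuous
      hasCompactSupport' := f.hasCompactSupport.comp_isClosedEmbedding he }
  map_add' _ _ := rfl
  map_smul' _ _ := rfl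

end ExtendByZero

end PGroupoid

namespace PGroupoid

section Reduction

variable {G : Type*} [PGroupoid G]

/-- An invariant subset of the unit space: `d(g) ∈ D` implies `r(g) ∈ D`. -/
structure InvariantSet (G : Type*) [PGroupoid G] where
  /-- the underlying subset of the unit space -/
  carrier : Set (UnitSpace G)
  rng_mem (g : G) : dom g ∈ carrier → rng g ∈ carrier

lemma InvariantSet.rng_mem_iff (D : InvariantSet G) (g : G) :
    rng g ∈ D.carrier ↔ dom g ∈ D.carrier :=
  ⟨fun h => by simpa using D.rng_mem g⁻¹ (by simpa using h), D.rng_mem g⟩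

/-- The complement `G⁽⁰⁾ \ D`. -/
def InvariantSet.compl (D : InvariantSet G) : InvariantSet G where
  carrier := D.carrierᶜ
  rng_mem g hg h := hg ((D.rng_mem_iff g).1 h)

/-- The reduction `G_D = {g ∈ G | d(g) ∈ D}` to an invariant subset `D`, with the relative
topology. -/
def Reduction (D : InvariantSet G) : Type _ := {g : G // dom g ∈ D.carrier}

namespace Reduction

variable {D : InvariantSet G}

/-- The inclusion `G_D ⊆ G`. -/
def val (x : Reduction D) : G := Subtype.val x

lemma val_injective : Injective (val : Reduction D → G) := Subtype.val_injective

lemma dom_val_mem (x : Reduction D) : dom x.val ∈ D.carrier := Subtype.property x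

open Classical in
/-- The product inherited from `G` (with a dummy value on non-composable pairs). -/
noncomputable instance : Mul (Reduction D) where
  mul a b := if h : Comp a.val b.val then
    ⟨a.val * b.val, by rw [dom_mul (comp_iff.1 h)]; exact b.2⟩ else a

instance : Inv (Reduction D) where
  inv a := ⟨a.val⁻¹, by rw [dom_inv]; exact D.rng_mem _ a.2⟩

@[simp] lemma val_inv (a : Reduction D) : (a⁻¹).val = a.val⁻¹ := rfl

lemma val_mul_aux {a b : Reduction D} (h : Comp a.val b.val) : (a * b).val = a.val * b.val :=
  congrArg val (dif_pos h : a * b = _)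

/-- The groupoid structure inherited from `G`. -/
noncomputable instance : PGroupoid (Reduction D) where
  Comp a b := Comp a.val b.val
  comp_mul_left {a b c} h h' := by
    rw [val_mul_aux h]
    exact comp_mul_left h h'
  comp_mul_right {a b c} h h' := by
    rw [val_mul_aux h']
    exact comp_mul_right h h'
  mul_assoc' {a b c} h h' := by
    apply val_injective
    rw [val_mul_aux (by rw [val_mul_aux h]; exact comp_mul_left h h'),
      val_mul_aux h, val_mul_aux (by rw [val_mul_aux h']; exact comp_mul_right h h'),
      val_mul_aux h']
    exact mul_assoc' h h'
  comp_inv a := comp_inv a.val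
  comp_inv_mul {a b} h := by
    rw [val_mul_aux h]
    exact comp_inv_mul h
  inv_mul_cancel' {a b} h := by
    apply val_injective
    rw [val_mul_aux (by rw [val_mul_aux h]; exact comp_inv_mul h), val_mul_aux h, val_inv]
    exact inv_mul_cancel' h
  comp_mul_inv {a b} h := by
    rw [val_mul_aux h]
    exact comp_mul_inv h
  mul_inv_cancel' {a b} h := by
    apply val_injective
    rw [val_mul_aux (by rw [val_mul_aux h]; exact comp_mul_inv h), val_mul_aux h, val_inv]
    exact mul_inv_cancel' h

lemma comp_def {a b : Reduction D} : Comp a b ↔ Comp a.val b.val := Iff.rfl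

lemma val_mul {a b : Reduction D} (h : Comp a b) : (a * b).val = a.val * b.val := val_mul_aux h

lemma val_rng (a : Reduction D) : ((rng a : UnitSpace _) : Reduction D).val = (rng a.val : G) := by
  rw [coe_rng, coe_rng, val_mul (comp_inv a), val_inv]

lemma val_dom (a : Reduction D) : ((dom a : UnitSpace _) : Reduction D).val = (dom a.val : G) := by
  rw [coe_dom, coe_dom, val_mul (comp_inv_inv_left a), val_inv]

lemma dom_eq_iff {a b : Reduction D} : dom a = dom b ↔ dom a.val = dom b.val := by
  constructor <;> intro h
  · apply Subtype.ext
    rw [← val_dom, ← val_dom, h]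
  · apply Subtype.ext
    apply val_injective
    rw [val_dom, val_dom, h]

instance [TopologicalSpace G] : TopologicalSpace (Reduction D) :=
  inferInstanceAs (TopologicalSpace {g : G // dom g ∈ D.carrier})

lemma isEmbedding_val [TopologicalSpace G] : IsEmbedding (val : Reduction D → G) :=
  IsEmbedding.subtypeVal

lemma range_val : range (val : Reduction D → G) = dom ⁻¹' D.carrier := Subtype.range_val

variable [TopologicalSpace G]

lemma isClosedEmbedding_val [TopGroupoid G] (hD : IsClosed D.carrier) :
    IsClosedEmbedding (val : Reduction D → G) :=
  ⟨isEmbedding_val, by rw [range_val]; exact hD.preimage continuous_dom⟩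

lemma isOpenEmbedding_val [TopGroupoid G] (hD : IsOpen D.carrier) :
    IsOpenEmbedding (val : Reduction D → G) :=
  ⟨isEmbedding_val, by rw [range_val]; exact hD.preimage continuous_dom⟩

instance [TopGroupoid G] : TopGroupoid (Reduction D) where
  toT2Space := isEmbedding_val.t2Space
  continuousOn_mul := by
    rw [isEmbedding_val.isInducing.continuousOn_iff]
    have h : ContinuousOn (fun p : Reduction D × Reduction D => p.1.val * p.2.val)
        {p | Comp p.1 p.2} :=
      TopGroupoid.continuousOn_mul.comp (f := fun p : Reduction D × Reduction D =>
          (p.1.val, p.2.val))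
        ((isEmbedding_val.continuous.comp continuous_fst).prodMk
          (isEmbedding_val.continuous.comp continuous_snd)).continuousOn fun p hp => hp
    exact h.congr fun p hp => val_mul hp
  continuous_inv := by
    rw [isEmbedding_val.continuous_iff]
    exact TopGroupoid.continuous_inv.comp isEmbedding_val.continuous

lemma isBisection_preimage [TopGroupoid G] {S : Set G} (hS : IsBisection S) :
    IsBisection (val ⁻¹' S : Set (Reduction D)) := by
  have hi : IsEmbedding (fun x : (val ⁻¹' S : Set (Reduction D)) => (⟨x.1.val, x.2⟩ : S)) :=
    IsEmbedding.of_comp (g := Subtype.val)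
      ((isEmbedding_val.continuous.comp continuous_subtype_val).subtype_mk _)
      continuous_subtype_val (isEmbedding_val.comp IsEmbedding.subtypeVal)
  have c := isEmbedding_val (D := D) |>.continuous
  constructor
  · have e : (val : Reduction D → G) ∘
        (fun x : (val ⁻¹' S : Set (Reduction D)) => ((rng (x : Reduction D) : UnitSpace _) :
          Reduction D)) =
        (fun x : S => ((rng (x : G) : UnitSpace G) : G)) ∘ fun x => ⟨x.1.val, x.2⟩ :=
      funext fun x => val_rng x.1
    refine ⟨IsEmbedding.of_comp ?_ c (e ▸ hS.1.isEmbedding.comp hi), ?_⟩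
    · exact continuous_subtype_val.comp (continuous_rng.comp continuous_subtype_val)
    · convert hS.1.isOpen_range.preimage c using 1
      ext y
      constructor
      · rintro ⟨x, rfl⟩
        exact ⟨⟨x.1.val, x.2⟩, (val_rng x.1).symm⟩
      · rintro ⟨x, hx⟩
        have hd : dom (x : G) ∈ D.carrier := by
          rw [← D.rng_mem_iff, ← dom_unit (rng (x : G))]
          simp only at hx
          rw [hx]
          exact y.2
        refine ⟨⟨⟨x.1, hd⟩, x.2⟩, val_injective ?_⟩
        exact (val_rng _).trans hx
  · have e : (val : Reduction D → G) ∘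
        (fun x : (val ⁻¹' S : Set (Reduction D)) => ((dom (x : Reduction D) : UnitSpace _) :
          Reduction D)) =
        (fun x : S => ((dom (x : G) : UnitSpace G) : G)) ∘ fun x => ⟨x.1.val, x.2⟩ :=
      funext fun x => val_dom x.1
    refine ⟨IsEmbedding.of_comp ?_ c (e ▸ hS.2.isEmbedding.comp hi), ?_⟩
    · exact continuous_subtype_val.comp (continuous_dom.comp continuous_subtype_val)
    · convert hS.2.isOpen_range.preimage c using 1
      ext y
      constructor
      · rintro ⟨x, rfl⟩
        exact ⟨⟨x.1.val, x.2⟩, (val_dom x.1).symm⟩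
      · rintro ⟨x, hx⟩
        have hd : dom (x : G) ∈ D.carrier := by
          rw [← dom_unit (dom (x : G))]
          simp only at hx
          rw [hx]
          exact y.2
        refine ⟨⟨⟨x.1, hd⟩, x.2⟩, val_injective ?_⟩
        exact (val_dom _).trans hx

instance [EtaleGroupoid G] : EtaleGroupoid (Reduction D) where
  isTopologicalBasis_bisection := by
    refine TopologicalSpace.isTopologicalBasis_of_isOpen_of_nhds (fun S hS => hS.1) ?_
    intro a V ha hV
    obtain ⟨W, hW, rfl⟩ := isEmbedding_val.isInducing.isOpen_iff.1 hV
    obtain ⟨S, hSo, hSb, haS, hSW⟩ := exists_bisection a.val hW ha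
    exact ⟨val ⁻¹' S, ⟨hSo.preimage isEmbedding_val.continuous, isBisection_preimage hSb⟩, haS,
      preimage_mono hSW⟩

end Reduction

end Reduction

section CanonicalMaps

lemma norm_le_of_intertwine {X Y : Type*} (e : X ≃ Y)
    (S : lp (fun _ : X => ℂ) 2 →L[ℂ] lp (fun _ : X => ℂ) 2)
    (T : lp (fun _ : Y => ℂ) 2 →L[ℂ] lp (fun _ : Y => ℂ) 2)
    (h : ∀ (ξ : lp (fun _ : X => ℂ) 2) (η : lp (fun _ : Y => ℂ) 2),
      (∀ x, ξ x = η (e x)) → ∀ x, S ξ x = T η (e x)) : ‖T‖ ≤ ‖S‖ := by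
  refine ContinuousLinearMap.opNorm_le_bound _ (norm_nonneg _) fun η => ?_
  have hn : ∀ (ξ : lp (fun _ : X => ℂ) 2) (η : lp (fun _ : Y => ℂ) 2),
      (∀ x, ξ x = η (e x)) → ‖ξ‖ = ‖η‖ := fun ξ η hξ => by
    rw [lp.norm_eq_tsum_rpow (by norm_num), lp.norm_eq_tsum_rpow (by norm_num), ← e.tsum_eq]
    simp only [hξ]
  have hm : Memℓp (fun x => η (e x)) 2 := by
    refine memℓp_gen ?_
    exact (e.summable_iff (f := fun y => ‖η y‖ ^ (2 : ℝ≥0∞).toReal)).2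
      ((lp.memℓp η).summable (by norm_num))
  set ξ : lp (fun _ : X => ℂ) 2 := ⟨fun x => η (e x), hm⟩
  have h0 : ∀ x, ξ x = η (e x) := fun x => rfl
  rw [← hn _ _ (h ξ η h0), ← hn ξ η h0]
  exact S.le_opNorm ξ

variable {G : Type*} [PGroupoid G]

/-- A unit of `G_D`, as a unit of `G`. -/
def unitOfReduction {D : InvariantSet G} (u : UnitSpace (Reduction D)) : UnitSpace G :=
  dom (u : Reduction D).val

lemma dom_eq_unit_iff {D : InvariantSet G} (u : UnitSpace (Reduction D)) (x : Reduction D) :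
    dom x = u ↔ dom x.val = unitOfReduction u := by
  conv_lhs => rw [← dom_unit u]
  exact Reduction.dom_eq_iff

/-- The identification of `(G_D)_u` with `G_u`, for `u ∈ D`. -/
def srcReductionEquiv {D : InvariantSet G} (u : UnitSpace (Reduction D)) :
    Src u ≃ Src (unitOfReduction u) where
  toFun x := ⟨(x : Reduction D).val, (dom_eq_unit_iff u _).1 x.2⟩
  invFun g := ⟨⟨g, by rw [g.2]; exact (u : Reduction D).2⟩, (dom_eq_unit_iff u _).2 g.2⟩
  left_inv _ := rfl
  right_inv _ := rfl

variable [TopologicalSpace G] [EtaleGroupoid G]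

lemma norm_regRep_reduction {D : InvariantSet G} (u : UnitSpace (Reduction D))
    (f : C_c(G, ℂ)) (f' : C_c(Reduction D, ℂ)) (hf : ∀ x, f' x = f x.val) :
    ‖regRep u f'‖ = ‖regRep (unitOfReduction u) f‖ := by
  have key : ∀ (ξ : L2 u) (η : L2 (unitOfReduction u)),
      (∀ x, ξ x = η (srcReductionEquiv u x)) →
      ∀ x, regRep u f' ξ x = regRep (unitOfReduction u) f η (srcReductionEquiv u x) := by
    intro ξ η h x
    rw [regRep_apply', regRep_apply', ← finsum_comp_equiv (srcReductionEquiv u)]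
    refine finsum_congr fun k => ?_
    rw [h, hf, Reduction.val_mul (comp_iff.2 (by rw [rng_inv, x.2, k.2]))]
    rfl
  refine le_antisymm ?_ (norm_le_of_intertwine (srcReductionEquiv u) _ _ key)
  refine norm_le_of_intertwine (srcReductionEquiv u).symm _ _ fun ξ η h x => ?_
  have := key η ξ (fun y => by simpa using (h (srcReductionEquiv u y)).symm)
    ((srcReductionEquiv u).symm x)
  simpa using this.symm

lemma norm_toReduced_restrict_le (D : InvariantSet G) (hD : IsClosed D.carrier) (f : C_c(G, ℂ)) :
    ‖toReduced (Reduction D) (restrictClosed _ (Reduction.isClosedEmbedding_val hD) f)‖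
      ≤ ‖toReduced G f‖ := by
  rw [norm_toReduced_le_iff _ (norm_nonneg _)]
  intro u
  rw [norm_regRep_reduction u f _ fun x => rfl]
  exact (norm_toReduced_le_iff f (norm_nonneg _)).1 le_rfl _

lemma norm_toReduced_extend (U : InvariantSet G) (hU : IsOpen U.carrier)
    (f : C_c(Reduction U, ℂ)) :
    ‖toReduced G (extendZero _ (Reduction.isOpenEmbedding_val hU) f)‖
      = ‖toReduced (Reduction U) f‖ := by
  have hf : ∀ x : Reduction U, f x = extendZero _ (Reduction.isOpenEmbedding_val hU) f x.val :=
    fun x => (extendZero_apply _ _ f x).symm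
  refine le_antisymm ?_ ?_
  · rw [norm_toReduced_le_iff _ (norm_nonneg _)]
    intro u
    by_cases hu : u ∈ U.carrier
    · have hmem : dom (u : G) ∈ U.carrier := by rwa [dom_unit]
      have hv := norm_regRep_reduction (dom (⟨u, hmem⟩ : Reduction U)) _ f hf
      have hu' : unitOfReduction (dom (⟨u, hmem⟩ : Reduction U)) = u := by
        rw [← (dom_eq_unit_iff _ (⟨u, hmem⟩ : Reduction U)).1 rfl]
        exact dom_unit u
      rw [hu'] at hv
      rw [← hv]
      exact (norm_toReduced_le_iff f (norm_nonneg _)).1 le_rfl _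
    · have h0 : regRep u (extendZero _ (Reduction.isOpenEmbedding_val hU) f) = 0 := by
        ext ξ g
        rw [regRep_apply]
        refine finsum_eq_zero_of_forall_eq_zero fun h => ?_
        rw [extendZero_apply', zero_mul]
        rw [Reduction.range_val]
        intro hh
        apply hu
        rw [← g.2, ← U.rng_mem_iff, ← h.2, U.rng_mem_iff]
        exact hh
      rw [h0, norm_zero]
      exact norm_nonneg _
  · rw [norm_toReduced_le_iff _ (norm_nonneg _)]
    intro u
    rw [norm_regRep_reduction u _ f hf]
    exact (norm_toReduced_le_iff _ (norm_nonneg _)).1 le_rfl _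

/-- For `D` closed and invariant, the canonical map `C_r^*(G) → C_r^*(G_D)`: the extension by
continuity of the restriction map `C_c(G) → C_c(G_D)`. -/
noncomputable def restrictionMap (D : InvariantSet G) (hD : IsClosed D.carrier) :
    ReducedCStar G →L[ℂ] ReducedCStar (Reduction D) :=
  (toReduced (Reduction D) ∘ₗ
    restrictClosed _ (Reduction.isClosedEmbedding_val hD)).extendOfNorm (toReduced G)

lemma restrictionMap_toReduced (D : InvariantSet G) (hD : IsClosed D.carrier) (f : C_c(G, ℂ)) :
    restrictionMap D hD (toReduced G f) =
      toReduced (Reduction D) (restrictClosed _ (Reduction.isClosedEmbedding_val hD) f) :=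
  LinearMap.extendOfNorm_eq denseRange_toReduced
    ⟨1, fun f => by rw [one_mul]; exact norm_toReduced_restrict_le D hD f⟩ f

/-- For `U` open and invariant, the canonical map `C_r^*(G_U) → C_r^*(G)`: the extension by
continuity of the map `C_c(G_U) → C_c(G)` that extends functions by zero. -/
noncomputable def inclusionMap (U : InvariantSet G) (hU : IsOpen U.carrier) :
    ReducedCStar (Reduction U) →L[ℂ] ReducedCStar G :=
  (toReduced G ∘ₗ
    extendZero _ (Reduction.isOpenEmbedding_val hU)).extendOfNorm (toReduced (Reduction U))

lemma inclusionMap_toReduced (U : InvariantSet G) (hU : IsOpen U.carrier)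
    (f : C_c(Reduction U, ℂ)) :
    inclusionMap U hU (toReduced (Reduction U) f) =
      toReduced G (extendZero _ (Reduction.isOpenEmbedding_val hU) f) :=
  LinearMap.extendOfNorm_eq denseRange_toReduced
    ⟨1, fun f => by rw [one_mul]; exact (norm_toReduced_extend U hU f).le⟩ f

end CanonicalMaps

section Properties

/-- `G` is inner exact: the sequence `0 → C_r^*(G_{G⁽⁰⁾ \ D}) → C_r^*(G) → C_r^*(G_D) → 0` is exact
for every closed invariant `D ⊆ G⁽⁰⁾`. -/
def IsInnerExact (G : Type*) [PGroupoid G] [TopologicalSpace G] [EtaleGroupoid G] : Prop :=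
  ∀ (D : InvariantSet G) (hD : IsClosed D.carrier),
    Injective (inclusionMap D.compl hD.isOpen_compl) ∧
    Exact (inclusionMap D.compl hD.isOpen_compl) (restrictionMap D hD) ∧
    Surjective (restrictionMap D hD)

/-- The canonical copy of `C_0(G⁽⁰⁾)` in `C_r^*(G)`: the closure of `C_c(G⁽⁰⁾)`, which is mapped
(isometrically) into `C_r^*(G)` by extending functions by zero outside `G⁽⁰⁾`. -/
noncomputable def unitAlgebra (G : Type*) [PGroupoid G] [TopologicalSpace G] [EtaleGroupoid G] :
    Submodule ℂ (ReducedCStar G) :=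
  (LinearMap.range (toReduced G ∘ₗ
    extendZero (Subtype.val : UnitSpace G → G) isOpenEmbedding_units)).topologicalClosure

/-- `G` has the intersection property: every nonzero closed two-sided ideal of `C_r^*(G)` meets
`C_0(G⁽⁰⁾)` nontrivially. (In a `C⋆`-algebra, closed two-sided ring ideals are automatically
complex subspaces.) -/
def HasIntersectionProperty (G : Type*) [PGroupoid G] [TopologicalSpace G] [EtaleGroupoid G] :
    Prop :=
  ∀ I : TwoSidedIdeal (ReducedCStar G), IsClosed (I : Set (ReducedCStar G)) → I ≠ ⊥ →
    (I : Set (ReducedCStar G)) ∩ (unitAlgebra G : Set (ReducedCStar G)) ≠ {0}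

/-- `G` has the residual intersection property: `G_D` has the intersection property for every
closed invariant `D ⊆ G⁽⁰⁾`. -/
def HasResidualIntersectionProperty (G : Type*) [PGroupoid G] [TopologicalSpace G]
    [EtaleGroupoid G] : Prop :=
  ∀ D : InvariantSet G, IsClosed D.carrier → HasIntersectionProperty (Reduction D)

end Properties

end PGroupoid

/-- The ideal property (IP) of a `C⋆`-algebra: every closed two-sided ideal is the closed two-sided
ideal generated by the projections it contains. -/
def HasIdealProperty (A : Type*) [NonUnitalCStarAlgebra A] : Prop :=
  ∀ I : TwoSidedIdeal A, IsClosed (I : Set A) →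
    (I : Set A) = closure (TwoSidedIdeal.span {p : A | p ∈ I ∧ IsStarProjection p} : Set A)

/-! Let `I` be a closed ideal and let `U` be the set of units at which some function in `I ∩
C_c(G⁽⁰⁾)` is nonzero. Then `U` is open. It is invariant because conjugating such a function by the
characteristic function of a compact open bisection moves its value from `d(g)` to `r(g)` without
leaving the unit space (`rng_mem_idealSupport`).

Ampleness supplies projections. A function can be inverted on a compact open set where it has no
zero, so every compact part of `U` lies in a compact open set `K` of units with `1_K ∈ I`
(`exists_charFun_mem_of_isCompact`). Every function in `C_c(G_U)` is fixed by right multiplication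
with such a `1_K`, so the image of `C_r^*(G_U)` lies in the closed ideal generated by the
projections of `I` (`inclusionMap_mem_closure_span`).

Put `D = G⁽⁰⁾ \ U` and let `q : C_r^*(G) → C_r^*(G_D)` be the restriction. By inner exactness `ker
q` is that image, so it remains to see that `q(I) = 0`. As `ker q ⊆ I`, the ideal `q(I)` is closed.
If it were nonzero, the residual intersection property would give it a nonzero element of `C_0(D)`,
hence the restriction of `1_K` for some compact open `K ⊆ G⁽⁰⁾` meeting `D`
(`exists_restrict_charFun_mem`). Since `ker q ⊆ I`, this gives `1_K ∈ I`, so `K ⊆ U`, a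
contradiction. Thus `I = ker q`. -/

namespace PGroupoid

/-! ### Closed two-sided ideals: nearby idempotents and images. -/

section ClosedIdeals

variable {A : Type*} [NonUnitalNormedRing A]

/-- A closed two-sided ideal contains every idempotent at distance less than `1` from it. -/
lemma mem_of_idempotent_of_norm_sub_lt_one (I : TwoSidedIdeal A) (hI : IsClosed (I : Set A))
    {p b : A} (hp : p * p = p) (hb : b ∈ I) (h : ‖p - b‖ < 1) : p ∈ I := by
  -- Modulo `I` the idempotent `p` agrees with `p - b`, so `p = p ^ (n + 1)` agrees with `(p - b) ^
  -- (n + 1)`, which tends to zero. The power is the witness `c`, and no quotient norm is needed.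
  have key : ∀ n : ℕ, ∃ c : A, ‖c‖ ≤ ‖p - b‖ ^ (n + 1) ∧ p - c ∈ I := by
    intro n
    induction n with
    | zero => exact ⟨p - b, by simp, by simpa using hb⟩
    | succ n ih =>
      obtain ⟨c, hc, hcI⟩ := ih
      refine ⟨c * (p - b), ?_, ?_⟩
      · rw [pow_succ]
        exact (norm_mul_le _ _).trans (by gcongr)
      · have e : p - c * (p - b) = (p - c) * p + c * b := by
          rw [mul_sub, sub_mul, hp]
          abel
        rw [e]
        exact I.add_mem (I.mul_mem_right _ _ hcI) (I.mul_mem_left _ _ hb)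
  choose c hc hcI using key
  have hlim : Filter.Tendsto c Filter.atTop (𝓝 0) :=
    squeeze_zero_norm hc
      ((Filter.tendsto_add_atTop_iff_nat 1).2 (tendsto_pow_atTop_nhds_zero_of_lt_one
        (norm_nonneg _) h))
  have : Filter.Tendsto (fun n => p - c n) Filter.atTop (𝓝 p) := by
    simpa using tendsto_const_nhds.sub hlim
  exact hI.mem_of_tendsto this (Filter.Eventually.of_forall hcI)

/-- The image of a two-sided ideal under a surjective ring homomorphism. -/
def imageIdeal {B : Type*} [NonUnitalNonAssocRing B] (I : TwoSidedIdeal A) (q : A →+ B)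
    (hmul : ∀ x y, q (x * y) = q x * q y) (hq : Surjective q) : TwoSidedIdeal B :=
  TwoSidedIdeal.mk' (q '' I) ⟨0, I.zero_mem, map_zero q⟩
    (by
      rintro _ _ ⟨x, hx, rfl⟩ ⟨y, hy, rfl⟩
      exact ⟨x + y, I.add_mem hx hy, map_add q x y⟩)
    (by
      rintro _ ⟨x, hx, rfl⟩
      exact ⟨-x, I.neg_mem hx, map_neg q x⟩)
    (by
      rintro x _ ⟨y, hy, rfl⟩
      obtain ⟨x, rfl⟩ := hq x
      exact ⟨x * y, I.mul_mem_left _ _ hy, hmul x y⟩)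
    (by
      rintro _ y ⟨x, hx, rfl⟩
      obtain ⟨y, rfl⟩ := hq y
      exact ⟨x * y, I.mul_mem_right _ _ hx, hmul x y⟩)

lemma coe_imageIdeal {B : Type*} [NonUnitalNonAssocRing B] (I : TwoSidedIdeal A) (q : A →+ B)
    (hmul : ∀ x y, q (x * y) = q x * q y) (hq : Surjective q) :
    (imageIdeal I q hmul hq : Set B) = q '' I :=
  TwoSidedIdeal.coe_mk' _ _ _ _ _ _

end ClosedIdeals

/-! ### Functions cut off to a compact open set. -/

section Cutoff

variable {X : Type*} [TopologicalSpace X] [T2Space X]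

/-- The function equal to `φ` on the compact open set `K` and to zero elsewhere. -/
noncomputable def cutoff (K : Set X) (hK : IsCompact K) (hKo : IsOpen K) (φ : X → ℂ)
    (hφ : ContinuousOn φ K) : C_c(X, ℂ) where
  toFun := K.indicator φ
  continuous_toFun := by
    rw [continuous_iff_continuousAt]
    intro x
    -- A compact set in a Hausdorff space is closed, so `K` is clopen and the function is locally
    -- either `φ` or zero.
    by_cases hx : x ∈ K
    · refine (hφ.continuousAt (hKo.mem_nhds hx)).congr ?_
      filter_upwards [hKo.mem_nhds hx] with y hy
      rw [indicator_of_mem hy]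
    · refine (continuousAt_const (y := (0 : ℂ))).congr ?_
      filter_upwards [hK.isClosed.isOpen_compl.mem_nhds hx] with y hy
      rw [indicator_of_notMem hy]
  hasCompactSupport' := HasCompactSupport.intro hK fun _ hx => indicator_of_notMem hx _

/-- The characteristic function of a compact open set. -/
noncomputable def charFun (K : Set X) (hK : IsCompact K) (hKo : IsOpen K) : C_c(X, ℂ) :=
  cutoff K hK hKo (fun _ => 1) continuousOn_const

variable {K : Set X} {hK : IsCompact K} {hKo : IsOpen K}

lemma cutoff_of_mem {φ : X → ℂ} {hφ : ContinuousOn φ K} {x : X} (hx : x ∈ K) :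
    cutoff K hK hKo φ hφ x = φ x := indicator_of_mem hx φ

lemma cutoff_of_notMem {φ : X → ℂ} {hφ : ContinuousOn φ K} {x : X} (hx : x ∉ K) :
    cutoff K hK hKo φ hφ x = 0 := indicator_of_notMem hx φ

lemma charFun_of_mem {x : X} (hx : x ∈ K) : charFun K hK hKo x = 1 := cutoff_of_mem hx

lemma charFun_of_notMem {x : X} (hx : x ∉ K) : charFun K hK hKo x = 0 := cutoff_of_notMem hx

lemma mem_of_charFun_ne_zero {x : X} (hx : charFun K hK hKo x ≠ 0) : x ∈ K :=
  by_contra fun h => hx (charFun_of_notMem h)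

end Cutoff

/-! ### Functions supported on the unit space. -/

section UnitFunctions

variable {G : Type*} [PGroupoid G]

lemma mul_dom_self (g : G) : g * (dom g : G) = g := by
  rw [coe_dom, ← pmul_assoc (by rw [rng_inv]) (by rw [dom_inv])]
  exact mul_inv_mul_right rfl

lemma rng_mul_self (g : G) : (rng g : G) * g = g := by
  rw [coe_rng]
  exact mul_inv_mul_right rfl

/-- A unit equals its own range, so `a⁻¹ * b` is `d(a)`, and multiplying by `a` on the left gives `b
= a`. -/
lemma eq_of_inv_mul_mem_units {a b : G} (h : rng a = rng b) (hu : a⁻¹ * b ∈ units G) : a = b := by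
  have h1 : dom a⁻¹ = rng b := by rw [dom_inv, h]
  have h2 : ((dom a : UnitSpace G) : G) = a⁻¹ * b := by
    have := rng_mul h1
    rw [rng_inv] at this
    rw [← this]
    exact congrArg Subtype.val (rng_unit ⟨_, hu⟩)
  calc a = a * (dom a : G) := (mul_dom_self a).symm
    _ = b := by rw [h2, mul_inv_mul h]

lemma eq_of_mul_inv_mem_units {a b : G} (h : dom a = dom b) (hu : a * b⁻¹ ∈ units G) :
    a = b := by
  have h1 : dom a = rng b⁻¹ := by rw [rng_inv, h]
  have h2 : ((rng b : UnitSpace G) : G) = a * b⁻¹ := by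
    have := dom_mul h1
    rw [dom_inv] at this
    rw [← this]
    exact congrArg Subtype.val (dom_unit ⟨_, hu⟩)
  calc a = a * b⁻¹ * b := (mul_inv_mul_right h).symm
    _ = b := by rw [← h2, rng_mul_self]

/-- In the convolution sum `h⁻¹ * g` must be a unit, which leaves only the term `h = g`. This turns
convolution by functions on the unit space into pointwise multiplication along `d`. -/
lemma convFun_of_support_right {f₁ f₂ : G → ℂ} (h : ∀ g ∉ units G, f₂ g = 0) (g : G) :
    convFun f₁ f₂ g = f₁ g * f₂ (dom g : G) := by
  unfold convFun
  rw [finsum_eq_single _ ⟨g, rfl⟩]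
  · rfl
  · rintro ⟨k, hk⟩ hne
    rw [h, mul_zero]
    exact fun hu => hne (Subtype.ext (eq_of_inv_mul_mem_units hk hu))

lemma Reduction.val_mem_units_iff {D : InvariantSet G} (x : Reduction D) :
    x.val ∈ units G ↔ x ∈ units (Reduction D) := by
  constructor
  · intro h
    have : x = (dom x : Reduction D) := val_injective (by
      rw [val_dom]
      exact congrArg Subtype.val (dom_unit ⟨_, h⟩).symm)
    rw [this]
    exact (dom x).2
  · intro h
    have := Reduction.val_dom x
    rw [dom_unit (⟨x, h⟩ : UnitSpace (Reduction D))] at this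
    rw [this]
    exact (dom x.val).2

variable [TopologicalSpace G] [EtaleGroupoid G]

lemma conv_of_support_right {f₁ f₂ : C_c(G, ℂ)} (h : ∀ g ∉ units G, f₂ g = 0) (g : G) :
    conv f₁ f₂ g = f₁ g * f₂ (dom g : G) := convFun_of_support_right h g

/-- On functions supported on the unit space, the reduced norm is at most the supremum norm. -/
lemma norm_toReduced_le_of_support {f : C_c(G, ℂ)} (h : ∀ g ∉ units G, f g = 0) {M : ℝ}
    (hM : 0 ≤ M) (hf : ∀ g, ‖f g‖ ≤ M) : ‖toReduced G f‖ ≤ M := by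
  rw [norm_toReduced_le_iff _ hM]
  intro u
  -- The matrix of `π_u(f)` is diagonal, since `g k⁻¹` is a unit only when `g = k`. It is therefore
  -- a band kernel of width `1`, and the general bound `N * M * ‖ξ‖` becomes `M * ‖ξ‖`.
  have heq : ∀ g k : Src u, f ((g : G) * (k : G)⁻¹) ≠ 0 → g = k := fun g k hne =>
    Subtype.ext (eq_of_mul_inv_mem_units (g.2.trans k.2.symm) (by_contra fun hu => hne (h _ hu)))
  have hker : IsBandKernel (fun g k : Src u => f ((g : G) * (k : G)⁻¹)) 1 M :=
    { row_finite := fun g => (finite_singleton g).subset fun k hk => (heq g k hk).symm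
      row_card := fun g => by
        rw [← ncard_singleton g]
        exact ncard_le_ncard fun k hk => (heq g k hk).symm
      col_finite := fun k => (finite_singleton k).subset fun g hg => heq g k hg
      col_card := fun k => by
        rw [← ncard_singleton k]
        exact ncard_le_ncard fun g hg => heq g k hg
      norm_le := fun g k => hf _ }
  refine ContinuousLinearMap.opNorm_le_bound _ hM fun ξ => ?_
  have e : regRep u f ξ = ⟨fun g => ∑ᶠ k : Src u, f (g * (k : G)⁻¹) * ξ k, hker.memℓp ξ⟩ :=
    lp.ext (funext fun g => regRep_apply' u f ξ g)
  rw [e]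
  simpa using hker.norm_le' hM ξ

/-- On functions supported in the units, convolution is the pointwise product and the involution is
complex conjugation, because a unit is its own inverse. A function with values `0` and `1` is thus a
projection. -/
lemma isStarProjection_toReduced_charFun {K : Set G} (hK : IsCompact K) (hKo : IsOpen K)
    (hKu : K ⊆ units G) : IsStarProjection (toReduced G (charFun K hK hKo)) := by
  have h0 : ∀ g ∉ units G, charFun K hK hKo g = 0 := fun g hg =>
    charFun_of_notMem fun h => hg (hKu h)
  have hd : ∀ g ∈ K, (dom g : G) = g := fun g hg => congrArg Subtype.val (dom_unit ⟨g, hKu hg⟩)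
  refine ⟨?_, ?_⟩
  · rw [IsIdempotentElem, ← toReduced_conv]
    congr 1
    ext g
    rw [conv_of_support_right h0]
    by_cases hg : g ∈ K
    · rw [hd g hg, charFun_of_mem hg, one_mul]
    · rw [charFun_of_notMem hg, zero_mul]
  · rw [IsSelfAdjoint, ← toReduced_invol]
    congr 1
    ext g
    change starRingEnd ℂ (charFun K hK hKo g⁻¹) = _
    have hinv : ∀ g ∈ K, g⁻¹ = g := fun g hg => by
      have h1 := mul_dom_self g⁻¹
      rw [dom_inv, show (rng g : G) = g from congrArg Subtype.val (rng_unit ⟨g, hKu hg⟩)] at h1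
      rw [← h1, ← coe_dom, hd g hg]
    by_cases hg : g ∈ K
    · rw [hinv g hg, charFun_of_mem hg, map_one]
    · have hg' : g⁻¹ ∉ K := fun h => hg (by rw [← pinv_inv g, hinv _ h]; exact h)
      rw [charFun_of_notMem hg, charFun_of_notMem hg', map_zero]

end UnitFunctions

/-! ### The support of an ideal in the unit space, and its projections. -/

section Support

variable {G : Type*} [PGroupoid G] [TopologicalSpace G]

lemma exists_compact_open [AmpleGroupoid G] (g : G) {V : Set G} (hV : IsOpen V) (hg : g ∈ V) :
    ∃ K, IsCompact K ∧ IsOpen K ∧ IsBisection K ∧ g ∈ K ∧ K ⊆ V := by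
  obtain ⟨S, hS, h1, h2⟩ :=
    (AmpleGroupoid.isTopologicalBasis_compact_bisection (G := G)).exists_subset_of_mem_open hg hV
  exact ⟨S, hS.1, hS.2.1, hS.2.2, h1, h2⟩

/-- The units at which some function in `I ∩ C_c(G⁽⁰⁾)` does not vanish. -/
def idealSupport [EtaleGroupoid G] (I : TwoSidedIdeal (ReducedCStar G)) : Set (UnitSpace G) :=
  {u | ∃ f : C_c(G, ℂ), (∀ g ∉ units G, f g = 0) ∧ toReduced G f ∈ I ∧ f (u : G) ≠ 0}

lemma isOpen_idealSupport [EtaleGroupoid G] (I : TwoSidedIdeal (ReducedCStar G)) :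
    IsOpen (idealSupport I) := by
  rw [isOpen_iff_forall_mem_open]
  rintro u ⟨f, h0, hI, hu⟩
  exact ⟨{v | f (v : G) ≠ 0}, fun v hv => ⟨f, h0, hI, hv⟩,
    isOpen_ne_fun (f.continuous.comp continuous_subtype_val) continuous_const, hu⟩

/-- For a compact open bisection `S` through `g`, the function `1_S * f * 1_S^*` belongs to the
ideal, is supported on the units and takes the value `f(d(g))` at `r(g)`. -/
lemma rng_mem_idealSupport [AmpleGroupoid G] (I : TwoSidedIdeal (ReducedCStar G)) (g : G)
    (hg : dom g ∈ idealSupport I) : rng g ∈ idealSupport I := by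
  obtain ⟨f, h0, hI, hu⟩ := hg
  obtain ⟨S, hSc, hSo, hSb, hgS, -⟩ := exists_compact_open g isOpen_univ (mem_univ g)
  set s := charFun S hSc hSo with hs
  have hval : ∀ x, conv (conv s f) (invol s) x =
      ∑ᶠ h : {h : G // rng h = rng x}, s h * f (dom (h : G) : G) *
        starRingEnd ℂ (s ((h : G)⁻¹ * x)⁻¹) := fun x => by
    change convFun _ _ _ = _
    unfold convFun
    refine finsum_congr fun h => ?_
    rw [conv_of_support_right h0]
    rfl
  refine ⟨conv (conv s f) (invol s), fun x hx => ?_, ?_, ?_⟩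
  · rw [hval]
    refine finsum_eq_zero_of_forall_eq_zero fun ⟨h, hh⟩ => ?_
    by_contra hne
    -- A nonzero term puts both `h` and `(h⁻¹ * x)⁻¹` in `S`. They have the same domain, so they
    -- coincide, and `x = h * h⁻¹` is a unit.
    have h1 : h ∈ S := mem_of_charFun_ne_zero (left_ne_zero_of_mul (left_ne_zero_of_mul hne))
    have h2 : (h⁻¹ * x)⁻¹ ∈ S :=
      mem_of_charFun_ne_zero fun h0' => right_ne_zero_of_mul hne (by
        simp only [hs]
        rw [h0', map_zero])
    have h3 : dom h⁻¹ = rng x := by rw [dom_inv, hh]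
    have h4 : (h⁻¹ * x)⁻¹ = h := hSb.dom_inj h2 h1 (by rw [dom_inv, rng_mul h3, rng_inv])
    apply hx
    have h5 : h⁻¹ * x = h⁻¹ := by rw [← pinv_inv (h⁻¹ * x), h4]
    rw [← mul_inv_mul hh, h5]
    exact ⟨h, rfl⟩
  · rw [toReduced_conv, toReduced_conv]
    exact I.mul_mem_right _ _ (I.mul_mem_left _ _ hI)
  -- As a bisection, `S` meets the range fibre of `r(g)` only in `g`, so the sum has one term,
  -- namely `f(d(g))`.
  · rw [hval, finsum_eq_single _ ⟨g, (rng_unit _).symm⟩]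
    · have h1 : (g⁻¹ * (rng g : G))⁻¹ = g := by
        have := mul_dom_self g⁻¹
        rw [dom_inv] at this
        rw [this, pinv_inv]
      simp only
      rw [h1, hs, charFun_of_mem hgS]
      simpa using hu
    · rintro ⟨k, hk⟩ hne
      have hk' : k ∉ S := fun hkS =>
        hne (Subtype.ext (hSb.rng_inj hkS hgS (hk.trans (rng_unit _))))
      simp only
      rw [hs, charFun_of_notMem hk', zero_mul, zero_mul]

/-- The support of `I ∩ C_c(G⁽⁰⁾)`, as an invariant set. -/
def invariantSupport [AmpleGroupoid G] (I : TwoSidedIdeal (ReducedCStar G)) : InvariantSet G where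
  carrier := idealSupport I
  rng_mem := rng_mem_idealSupport I

variable [AmpleGroupoid G] (I : TwoSidedIdeal (ReducedCStar G))

/-- Take a function `f` of the ideal with `f(u) ≠ 0` and a compact open neighbourhood `K` of `u` on
which `f` has no zero. Then `1_K` is the product of `f` with the function equal to `1/f` on `K` and
to zero elsewhere. -/
lemma exists_charFun_mem {u : UnitSpace G} (hu : u ∈ idealSupport I) :
    ∃ (K : Set G) (hK : IsCompact K) (hKo : IsOpen K), K ⊆ units G ∧ (u : G) ∈ K ∧
      toReduced G (charFun K hK hKo) ∈ I := by
  obtain ⟨f, h0, hI, hu⟩ := hu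
  obtain ⟨K, hK, hKo, -, huK, hKs⟩ := exists_compact_open (u : G)
    (isOpen_ne_fun f.continuous continuous_const : IsOpen {g | f g ≠ 0}) hu
  have hKu : K ⊆ units G := fun g hg => by_contra fun h => hKs hg (h0 g h)
  refine ⟨K, hK, hKo, hKu, huK, ?_⟩
  have hφ : ContinuousOn (fun g => (f g)⁻¹) K := f.continuous.continuousOn.inv₀ hKs
  have e : charFun K hK hKo = conv (cutoff K hK hKo _ hφ) f := by
    ext g
    rw [conv_of_support_right h0]
    by_cases hg : g ∈ K
    · rw [charFun_of_mem hg, cutoff_of_mem hg,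
        show (dom g : G) = g from congrArg Subtype.val (dom_unit ⟨g, hKu hg⟩),
        inv_mul_cancel₀ (hKs hg)]
    · rw [charFun_of_notMem hg, cutoff_of_notMem hg, zero_mul]
  rw [e, toReduced_conv]
  exact I.mul_mem_left _ _ hI

/-- Finitely many of the local sets cover `C`, and membership in the ideal passes to unions because
`1_{K ∪ L} = 1_K + 1_L - 1_K 1_L`. -/
lemma exists_charFun_mem_of_isCompact {C : Set (UnitSpace G)} (hC : IsCompact C)
    (hCI : C ⊆ idealSupport I) :
    ∃ (K : Set G) (hK : IsCompact K) (hKo : IsOpen K), K ⊆ units G ∧ Subtype.val '' C ⊆ K ∧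
      toReduced G (charFun K hK hKo) ∈ I := by
  refine hC.induction_on (p := fun C : Set (UnitSpace G) => ∃ (K : Set G) (hK : IsCompact K)
    (hKo : IsOpen K), K ⊆ units G ∧ Subtype.val '' C ⊆ K ∧ toReduced G (charFun K hK hKo) ∈ I)
    ?_ ?_ ?_ ?_
  · refine ⟨∅, isCompact_empty, isOpen_empty, empty_subset _, by simp, ?_⟩
    have : charFun (∅ : Set G) isCompact_empty isOpen_empty = 0 := by
      ext g
      exact charFun_of_notMem (notMem_empty g)
    rw [this, map_zero]
    exact I.zero_mem
  · rintro s t hst ⟨K, hK, hKo, hKu, htK, hKI⟩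
    exact ⟨K, hK, hKo, hKu, (image_mono hst).trans htK, hKI⟩
  · rintro s t ⟨K, hK, hKo, hKu, hsK, hKI⟩ ⟨L, hL, hLo, hLu, htL, hLI⟩
    refine ⟨K ∪ L, hK.union hL, hKo.union hLo, union_subset hKu hLu, ?_, ?_⟩
    · rw [image_union]
      exact union_subset_union hsK htL
    · have h0 : ∀ g ∉ units G, charFun L hL hLo g = 0 := fun g hg =>
        charFun_of_notMem fun h => hg (hLu h)
      have e : charFun (K ∪ L) (hK.union hL) (hKo.union hLo) =
          charFun K hK hKo + charFun L hL hLo - conv (charFun K hK hKo) (charFun L hL hLo) := by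
        ext g
        rw [CompactlySupportedContinuousMap.sub_apply, CompactlySupportedContinuousMap.add_apply,
          conv_of_support_right h0]
        by_cases hg : g ∈ K
        · rw [charFun_of_mem (mem_union_left L hg), charFun_of_mem hg,
            show (dom g : G) = g from congrArg Subtype.val (dom_unit ⟨g, hKu hg⟩)]
          ring
        · rw [charFun_of_notMem hg, zero_mul, zero_add, sub_zero]
          by_cases hg' : g ∈ L
          · rw [charFun_of_mem (mem_union_right K hg'), charFun_of_mem hg']
          · rw [charFun_of_notMem (fun h => h.elim hg hg'), charFun_of_notMem hg']
      rw [e, map_sub, map_add, toReduced_conv]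
      exact I.sub_mem (I.add_mem hKI hLI) (I.mul_mem_left _ _ hLI)
  · intro u hu
    obtain ⟨K, hK, hKo, hKu, huK, hKI⟩ := exists_charFun_mem I (hCI hu)
    exact ⟨Subtype.val ⁻¹' K,
      mem_nhdsWithin_of_mem_nhds ((hKo.preimage continuous_subtype_val).mem_nhds huK),
      K, hK, hKo, hKu, image_preimage_subset _ _, hKI⟩

/-- The image of `C_r^*(G_U)`, for `U` contained in the support of `I ∩ C_c(G⁽⁰⁾)`, lies in the
closed ideal generated by the projections of `I`. -/
lemma inclusionMap_mem_closure_span (U : InvariantSet G) (hU : IsOpen U.carrier)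
    (hUI : U.carrier ⊆ idealSupport I) (x : ReducedCStar (Reduction U)) :
    inclusionMap U hU x ∈
      closure (TwoSidedIdeal.span {p : ReducedCStar G | p ∈ I ∧ IsStarProjection p} :
        Set (ReducedCStar G)) := by
  -- Elements of `C_c(G_U)` land in the span itself; the closure only accounts for their limits.
  refine map_mem_closure (inclusionMap U hU).continuous (denseRange_toReduced x) ?_
  rintro _ ⟨f, rfl⟩
  rw [inclusionMap_toReduced]
  set F := extendZero _ (Reduction.isOpenEmbedding_val hU) f with hF
  have hC : IsCompact ((fun y : Reduction U => dom y.val) '' tsupport f) :=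
    f.hasCompactSupport.image (continuous_dom.comp Reduction.isEmbedding_val.continuous)
  obtain ⟨K, hK, hKo, hKu, hCK, hKI⟩ := exists_charFun_mem_of_isCompact I hC (by
    rintro _ ⟨y, -, rfl⟩
    exact hUI y.dom_val_mem)
  have h0 : ∀ g ∉ units G, charFun K hK hKo g = 0 := fun g hg =>
    charFun_of_notMem fun h => hg (hKu h)
  -- `K` contains `d(g)` for each `g` in the support of `F`, so right multiplication by `1_K` fixes
  -- `F`. This displays `F` as a multiple of a projection of `I`.
  have e : F = conv F (charFun K hK hKo) := by
    ext g
    rw [conv_of_support_right h0]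
    by_cases hg : g ∈ range (Reduction.val : Reduction U → G)
    · obtain ⟨y, rfl⟩ := hg
      rw [hF, extendZero_apply]
      by_cases hy : f y = 0
      · rw [hy, zero_mul]
      · rw [charFun_of_mem (hCK ⟨_, ⟨y, subset_tsupport _ hy, rfl⟩, rfl⟩), mul_one]
    · rw [hF, extendZero_apply' _ _ _ _ hg, zero_mul]
  rw [e, toReduced_conv]
  exact TwoSidedIdeal.mul_mem_left _ _ _
    (TwoSidedIdeal.subset_span ⟨hKI, isStarProjection_toReduced_charFun hK hKo hKu⟩)

end Support

/-! ### The restriction homomorphism to a closed invariant set. -/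

section Restriction

variable {G : Type*} [PGroupoid G] [TopologicalSpace G]

/-- By invariance of `D`, a range fibre of `G` that meets `G_D` lies entirely in it, so both
convolution sums run over the same arrows. -/
lemma restrictClosed_conv [EtaleGroupoid G] (D : InvariantSet G) (hD : IsClosed D.carrier)
    (f₁ f₂ : C_c(G, ℂ)) :
    restrictClosed _ (Reduction.isClosedEmbedding_val hD) (conv f₁ f₂) =
      conv (restrictClosed _ (Reduction.isClosedEmbedding_val hD) f₁)
        (restrictClosed _ (Reduction.isClosedEmbedding_val hD) f₂) := by
  ext x
  change convFun f₁ f₂ x.val = convFun (f₁ ∘ Reduction.val) (f₂ ∘ Reduction.val) x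
  have hr : ∀ y : Reduction D, rng y = rng x ↔ rng y.val = rng x.val := fun y => by
    rw [← dom_inv, ← dom_inv, Reduction.dom_eq_iff]
    simp
  let e : {y : Reduction D // rng y = rng x} ≃ {h : G // rng h = rng x.val} :=
    { toFun := fun y => ⟨y.1.val, (hr _).1 y.2⟩
      invFun := fun h => ⟨⟨h, by rw [← D.rng_mem_iff, h.2, D.rng_mem_iff]; exact x.2⟩,
        (hr _).2 h.2⟩
      left_inv := fun _ => rfl
      right_inv := fun _ => rfl }
  unfold convFun
  rw [← finsum_comp_equiv e]
  refine finsum_congr fun y => ?_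
  simp only [comp_apply]
  rw [Reduction.val_mul (comp_iff.2 (by rw [dom_inv, y.2]))]
  rfl

/-- The map is defined only as a continuous linear extension; multiplicativity is inherited from the
dense image of `C_c(G)`. It makes the image of an ideal an ideal. -/
lemma restrictionMap_mul [EtaleGroupoid G] (D : InvariantSet G) (hD : IsClosed D.carrier)
    (x y : ReducedCStar G) :
    restrictionMap D hD (x * y) = restrictionMap D hD x * restrictionMap D hD y := by
  refine denseRange_toReduced.induction_on₂ (p := fun x y =>
    restrictionMap D hD (x * y) = restrictionMap D hD x * restrictionMap D hD y) ?_ ?_ x y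
  · have hc := (restrictionMap D hD).continuous
    exact isClosed_eq (hc.comp continuous_mul)
      ((hc.comp continuous_fst).mul (hc.comp continuous_snd))
  · intro f₁ f₂
    rw [← toReduced_conv, restrictionMap_toReduced, restrictionMap_toReduced,
      restrictionMap_toReduced, restrictClosed_conv D hD, toReduced_conv]

/-- A closed ideal of `C_r^*(G_D)` that meets `C_0(D)` contains the characteristic function of
`K ∩ D` for some compact open set `K` of units of `G` that meets `D`. -/
lemma exists_restrict_charFun_mem [AmpleGroupoid G] (D : InvariantSet G)
    (hD : IsClosed D.carrier) (J : TwoSidedIdeal (ReducedCStar (Reduction D)))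
    (hJ : IsClosed (J : Set (ReducedCStar (Reduction D))))
    {a : ReducedCStar (Reduction D)} (haJ : a ∈ J) (hau : a ∈ unitAlgebra (Reduction D))
    (ha : a ≠ 0) :
    ∃ (K : Set G) (hK : IsCompact K) (hKo : IsOpen K), K ⊆ units G ∧
      (∃ u ∈ D.carrier, (u : G) ∈ K) ∧
      toReduced _ (restrictClosed _ (Reduction.isClosedEmbedding_val hD) (charFun K hK hKo))
        ∈ J := by
  have hn : 0 < ‖a‖ := norm_pos_iff.2 ha
  obtain ⟨_, ⟨f₀, rfl⟩, hf⟩ := Metric.mem_closure_iff.1 hau (‖a‖ / 3) (by positivity)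
  rw [LinearMap.comp_apply] at hf
  set f := extendZero (Subtype.val : UnitSpace (Reduction D) → Reduction D)
    isOpenEmbedding_units f₀ with hfdef
  have h0 : ∀ x ∉ units (Reduction D), f x = 0 := fun x hx =>
    extendZero_apply' _ _ _ _ (by rwa [Subtype.range_coe])
  rw [dist_eq_norm] at hf
  -- The reduced norm of `f` is at most its supremum norm. A bound `2/3 * ‖a‖` on `f` would thus
  -- give `‖a‖ ≤ ‖a - f‖ + ‖f‖ < ‖a‖`.
  have hlarge : ∃ v, 2 / 3 * ‖a‖ < ‖f v‖ := by
    by_contra! hcon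
    have h1 := norm_toReduced_le_of_support h0 (by positivity) hcon
    have h2 := norm_sub_norm_le a (toReduced (Reduction D) f)
    linarith
  obtain ⟨v, hv⟩ := hlarge
  have hvu : v ∈ units (Reduction D) := by
    by_contra h
    rw [h0 v h, norm_zero] at hv
    linarith
  have hVo : IsOpen {x | 2 / 3 * ‖a‖ < ‖f x‖} :=
    isOpen_lt continuous_const f.continuous.norm
  -- The compact open set is chosen in `G` rather than in `G_D`, so that its characteristic function
  -- already lives in `C_c(G)` and restricts to the desired one.
  obtain ⟨W, hW, hWV⟩ := Reduction.isEmbedding_val.isInducing.isOpen_iff.1 hVo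
  obtain ⟨K, hK, hKo, -, hvK, hKW⟩ := exists_compact_open v.val (hW.inter isOpen_units)
    ⟨by rw [← mem_preimage, hWV]; exact hv, (Reduction.val_mem_units_iff v).2 hvu⟩
  have hKu : K ⊆ units G := fun g hg => (hKW hg).2
  refine ⟨K, hK, hKo, hKu, ⟨dom v.val, v.dom_val_mem, ?_⟩, ?_⟩
  · rwa [show (dom v.val : G) = v.val from congrArg Subtype.val (dom_unit ⟨_, hKu hvK⟩)]
  have hL : IsCompact (Reduction.val ⁻¹' K : Set (Reduction D)) :=
    (Reduction.isClosedEmbedding_val hD).isCompact_preimage hK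
  have hLo : IsOpen (Reduction.val ⁻¹' K : Set (Reduction D)) :=
    hKo.preimage Reduction.isEmbedding_val.continuous
  have hLu : (Reduction.val ⁻¹' K : Set (Reduction D)) ⊆ units (Reduction D) := fun x hx =>
    (Reduction.val_mem_units_iff x).1 (hKu hx)
  have hLV : ∀ x ∈ (Reduction.val ⁻¹' K : Set (Reduction D)), 2 / 3 * ‖a‖ < ‖f x‖ := fun x hx => by
    have : x ∈ {x | 2 / 3 * ‖a‖ < ‖f x‖} := by
      rw [← hWV]
      exact (hKW hx).1
    exact this
  have hne : ∀ x ∈ (Reduction.val ⁻¹' K : Set (Reduction D)), f x ≠ 0 := fun x hx h => by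
    have := hLV x hx
    rw [h, norm_zero] at this
    linarith
  have hres : restrictClosed _ (Reduction.isClosedEmbedding_val hD) (charFun K hK hKo) =
      charFun (Reduction.val ⁻¹' K : Set (Reduction D)) hL hLo := rfl
  rw [hres]
  have hφ : ContinuousOn (fun x => (f x)⁻¹) (Reduction.val ⁻¹' K : Set (Reduction D)) :=
    f.continuous.continuousOn.inv₀ hne
  -- `k` is `1/f` on the set where `|f| > 2/3 * ‖a‖` has been arranged, so `k * f` is the
  -- characteristic function and `‖k‖ ≤ (2/3 * ‖a‖)⁻¹`.
  set k := cutoff _ hL hLo _ hφ with hk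
  have hk0 : ∀ x ∉ units (Reduction D), k x = 0 := fun x hx =>
    cutoff_of_notMem fun h => hx (hLu h)
  have e : charFun (Reduction.val ⁻¹' K : Set (Reduction D)) hL hLo = conv k f := by
    ext x
    rw [conv_of_support_right h0]
    by_cases hx : x ∈ (Reduction.val ⁻¹' K : Set (Reduction D))
    · rw [charFun_of_mem hx, hk, cutoff_of_mem hx,
        show (dom x : Reduction D) = x from congrArg Subtype.val (dom_unit ⟨x, hLu hx⟩),
        inv_mul_cancel₀ (hne x hx)]
    · rw [charFun_of_notMem hx, hk, cutoff_of_notMem hx, zero_mul]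
  have hkn : ‖toReduced _ k‖ ≤ (2 / 3 * ‖a‖)⁻¹ := by
    refine norm_toReduced_le_of_support hk0 (by positivity) fun x => ?_
    by_cases hx : x ∈ (Reduction.val ⁻¹' K : Set (Reduction D))
    · rw [hk, cutoff_of_mem hx, norm_inv]
      exact inv_anti₀ (by positivity) (hLV x hx).le
    · rw [hk, cutoff_of_notMem hx, norm_zero]
      positivity
  -- The element `k * a` of `J` approximates the projection `k * f`: their distance is at most `‖k‖
  -- * ‖f - a‖ ≤ 1/2`.
  refine mem_of_idempotent_of_norm_sub_lt_one J hJ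
    (isStarProjection_toReduced_charFun hL hLo hLu).isIdempotentElem
    (J.mul_mem_left (toReduced _ k) a haJ) ?_
  rw [e, toReduced_conv, ← mul_sub]
  rw [norm_sub_rev] at hf
  calc _ ≤ ‖toReduced _ k‖ * ‖toReduced _ f - a‖ := norm_mul_le _ _
    _ ≤ (2 / 3 * ‖a‖)⁻¹ * (‖a‖ / 3) := by gcongr
    _ = 1 / 2 := by field_simp
    _ < 1 := by norm_num

end Restriction

end PGroupoid

/-! ### The ideal property. -/

open PGroupoid in
theorem mainTheorem10 (G : Type*) [PGroupoid G] [TopologicalSpace G] [LocallyCompactSpace G]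
    [PGroupoid.AmpleGroupoid G] (hexact : PGroupoid.IsInnerExact G)
    (hrip : PGroupoid.HasResidualIntersectionProperty G) :
    HasIdealProperty (PGroupoid.ReducedCStar G) := by
  intro I hI
  set P : Set (ReducedCStar G) := {p | p ∈ I ∧ IsStarProjection p} with hP
  have hPI : closure (TwoSidedIdeal.span P : Set (ReducedCStar G)) ⊆ I :=
    closure_minimal (TwoSidedIdeal.span_le.2 fun p hp => hp.1) hI
  refine Subset.antisymm ?_ hPI
  set D : InvariantSet G := (invariantSupport I).compl with hDdef
  have hD : IsClosed D.carrier := (isOpen_idealSupport I).isClosed_compl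
  obtain ⟨-, hex, hsurj⟩ := hexact D hD
  set q := restrictionMap D hD with hq
  have hker : ∀ x, q x = 0 → x ∈ closure (TwoSidedIdeal.span P : Set (ReducedCStar G)) := by
    intro x hx
    obtain ⟨y, rfl⟩ := (hex x).1 hx
    refine inclusionMap_mem_closure_span I D.compl hD.isOpen_compl ?_ y
    -- The open set of the exact sequence is the double complement of the support of `I`.
    exact (compl_compl (idealSupport I)).subset
  -- Since `ker q ⊆ I`, the ideal is saturated for `q`. This yields closedness of its image, `q`
  -- being a quotient map, and later lets elements of `q(I)` be lifted back into `I`.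
  have hpre : q ⁻¹' (q '' I) = (I : Set (ReducedCStar G)) := by
    refine Subset.antisymm ?_ (subset_preimage_image _ _)
    rintro x ⟨y, hy, hyx⟩
    have h1 : x - y ∈ I := hPI (hker _ (by rw [map_sub, hyx, sub_self]))
    simpa using I.add_mem h1 hy
  set J := imageIdeal I (q : ReducedCStar G →+ ReducedCStar (Reduction D))
    (restrictionMap_mul D hD) hsurj
  have hJc : (J : Set (ReducedCStar (Reduction D))) = q '' I := coe_imageIdeal _ _ _ _
  have hJ : IsClosed (J : Set (ReducedCStar (Reduction D))) := by
    rw [hJc, ← (q.isQuotientMap hsurj).isClosed_preimage, hpre]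
    exact hI
  have hbot : J = ⊥ := by
    by_contra hne
    have hint := hrip D hD J hJ hne
    obtain ⟨a, ⟨haJ, hau⟩, ha⟩ : ∃ a, a ∈ (J : Set (ReducedCStar (Reduction D))) ∩
        (unitAlgebra (Reduction D) : Set (ReducedCStar (Reduction D))) ∧ a ≠ 0 := by
      by_contra! hcon
      exact hint (Subset.antisymm hcon
        (singleton_subset_iff.2 ⟨J.zero_mem, (unitAlgebra _).zero_mem⟩))
    obtain ⟨K, hK, hKo, hKu, ⟨u, huD, huK⟩, hKJ⟩ := exists_restrict_charFun_mem D hD J hJ haJ hau ha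
    rw [← restrictionMap_toReduced] at hKJ
    have hKI : toReduced G (charFun K hK hKo) ∈ (I : Set (ReducedCStar G)) := by
      rw [← hpre, ← hJc]
      exact hKJ
    -- Now `1_K ∈ I` witnesses that `u` belongs to the support of `I`, although `u` was taken in its
    -- complement `D`.
    refine huD ⟨charFun K hK hKo, fun g hg => charFun_of_notMem fun h => hg (hKu h), hKI, ?_⟩
    rw [charFun_of_mem huK]
    exact one_ne_zero
  intro x hx
  refine hker x ?_
  have : q x ∈ (J : Set (ReducedCStar (Reduction D))) := by
    rw [hJc]
    exact mem_image_of_mem q hx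
  rw [hbot] at this
  exact (TwoSidedIdeal.mem_bot _).1 this
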